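/- Consider stochastic bandit instances with $n$ arms: arm $i$ has an unknown reward distribution $\nu_i$ on $[0,1]$ with mean $\mu_i$, and each pull of arm $i$ yields an independent sample of $\nu_i$. A (randomized, adaptive) algorithm for Best Arm Retention pulls arms one at a time, stops at a random time $T\in\{0,1,2,\dots\}\cup\{\infty\}$, where the decision to stop depends only on its own internal randomness and on the arms pulled and rewards observed so far, and then outputs a set of $m$ of the $n$ arms. An arm $i$ is $\varepsilon$-optimal if $\max_j\mu_j-\mu_i<\varepsilon$. The algorithm is $(\varepsilon,\delta)$-PAC if on every instance, with probability at least $1-\delta$, it stops and the set that it outputs contains an $\varepsilon$-optimal arm. The sample complexity of an algorithm is the supremum over all instances of the expected value of $T$; the sample complexity of $(\varepsilon,\delta)$-Best Arm Retention is the infimum of the sample complexities of all $(\varepsilon,\delta)$-PAC algorithms. **Theorem 1.** For every $\beta\in(0,1)$ there are constants $c,C>0$, depending only on $\beta$, such that for all integers $1\le m<n$ and all real $0<\varepsilon\le\frac18$ and $0<\delta\le\frac{n-m}{n}(1-\beta)$ the following holds. 1. Every $(\varepsilon,\delta)$-PAC algorithm has sample complexity at least $c\,\frac{n-m}{\varepsilon^2}\log\frac{n-m}{n\delta}$.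 2. There is an $(\varepsilon,\delta)$-PAC algorithm that always draws the same number $N$ of samples, with $N\le C\,\frac{n-m}{\varepsilon^2}\log\frac{n-m}{n\delta}$. Consequently, the sample complexity of $(\varepsilon,\delta)$-Best Arm Retention lies between $c\,\frac{n-m}{\varepsilon^2}\log\frac{n-m}{n\delta}$ and $C\,\frac{n-m}{\varepsilon^2}\log\frac{n-m}{n\delta}$, that is, it is $\Theta\left(\frac{n-m}{\varepsilon^2}\log\frac{n-m}{n\delta}\right)$ for fixed $\beta$. -/

import Mathlib

open MeasureTheory
open scoped ENNReal

namespace BestArmRetention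

/-- A stochastic bandit instance with `n` arms: the reward of arm `i` is drawn from the
probability distribution `law i`, supported on the interval `[0, 1]`. -/
structure Instance (n : ℕ) where
  law : Fin n → Measure ℝ
  isProb : ∀ i, IsProbabilityMeasure (law i)
  supp : ∀ i, ∀ᵐ x ∂(law i), x ∈ Set.Icc (0 : ℝ) 1

attribute [instance] Instance.isProb

/-- The mean reward of arm `i`. -/
noncomputable def Instance.mean {n : ℕ} (ν : Instance n) (i : Fin n) : ℝ :=
  ∫ x, x ∂(ν.law i)

/-- Arm `i` is `ε`-optimal: the gap between the largest mean and its mean is less than `ε`. -/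
def Instance.IsEpsOptimal {n : ℕ} (ν : Instance n) (ε : ℝ) (i : Fin n) : Prop :=
  ∀ j, ν.mean j - ν.mean i < ε

/-- The law of the reward table `x`, where `x t i` is the reward that arm `i` yields if it is
pulled in round `t`: all entries are independent and `x t i` has distribution `law i`. -/
noncomputable def Instance.rewardLaw {n : ℕ} (ν : Instance n) : Measure (ℕ → Fin n → ℝ) :=
  Measure.infinitePi (fun _ : ℕ => Measure.pi ν.law)

/-- What has been observed in the first `t` rounds: the pulled arms and the received rewards. -/
abbrev History (n t : ℕ) : Type := Fin t → Fin n × ℝ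

/-- A (randomized, adaptive) algorithm that keeps `m` of `n` arms. Its internal randomness is a
seed, drawn once, independently of the rewards. After `t` rounds it decides from the seed and the
history whether to stop (`halt`), which set of `m` arms to keep if it halts (`retain`), and which
arm to pull next if it does not stop (`pull`). -/
structure Algorithm (n m : ℕ) where
  Seed : Type
  measurableSpaceSeed : MeasurableSpace Seed
  seedLaw : Measure Seed
  isProb : IsProbabilityMeasure seedLaw
  pull : (t : ℕ) → Seed × History n t → Fin n
  measurable_pull : ∀ t, Measurable (pull t)
  halt : (t : ℕ) → Seed × History n t → Bool
  measurable_halt : ∀ t, Measurable (halt t)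
  retain : (t : ℕ) → Seed × History n t → Finset (Fin n)
  measurable_retain : ∀ t S, MeasurableSet {p | retain t p = S}
  card_retain : ∀ t p, (retain t p).card = m

attribute [instance] Algorithm.measurableSpaceSeed Algorithm.isProb

namespace Algorithm

variable {n m : ℕ}

/-- A sample point: the seed of the algorithm and the reward table. -/
abbrev Outcome (A : Algorithm n m) : Type := A.Seed × (ℕ → Fin n → ℝ)

/-- The probability law of the algorithm running on the instance `ν`. -/
noncomputable def prob (A : Algorithm n m) (ν : Instance n) : Measure A.Outcome :=
  A.seedLaw.prod ν.rewardLaw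

/-- The history of the first `t` rounds: in each round an arm `a` is chosen from the seed and the
past, and the reward of that arm in that round is observed. (It is irrelevant how the history is
continued after the algorithm has stopped.) -/
def history (A : Algorithm n m) (ω : A.Outcome) : (t : ℕ) → History n t
  | 0 => Fin.elim0
  | t + 1 =>
    let h := history A ω t
    let a := A.pull t (ω.1, h)
    Fin.snoc (α := fun _ => Fin n × ℝ) h (a, ω.2 t a)

/-- The number `T` of samples: the first time at which the algorithm stops, `⊤` if it never
stops. -/
noncomputable def samples (A : Algorithm n m) (ω : A.Outcome) : ℕ∞ :=
  ⨅ (t : ℕ) (_ : A.halt t (ω.1, A.history ω t) = true), (t : ℕ∞)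

/-- The algorithm stops, and the set that it keeps contains an `ε`-optimal arm of `ν`. -/
def Succeeds (A : Algorithm n m) (ν : Instance n) (ε : ℝ) (ω : A.Outcome) : Prop :=
  ∃ t : ℕ, A.samples ω = t ∧ ∃ i ∈ A.retain t (ω.1, A.history ω t), ν.IsEpsOptimal ε i

/-- The algorithm is `(ε, δ)`-PAC for best arm retention: on every instance it keeps an
`ε`-optimal arm with probability at least `1 - δ`. -/
def IsPAC (A : Algorithm n m) (ε δ : ℝ) : Prop :=
  ∀ ν : Instance n, ENNReal.ofReal (1 - δ) ≤ A.prob ν {ω | A.Succeeds ν ε ω}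

/-- The sample complexity of an algorithm: its expected number of samples on a worst-case
instance. -/
noncomputable def sampleComplexity (A : Algorithm n m) : ℝ≥0∞ :=
  ⨆ ν : Instance n, ∫⁻ ω, ((A.samples ω : ℕ∞) : ℝ≥0∞) ∂(A.prob ν)

end Algorithm

/-- The sample complexity of `(ε, δ)`-PAC best arm retention: the least sample complexity of an
`(ε, δ)`-PAC algorithm. -/
noncomputable def sampleComplexity (n m : ℕ) (ε δ : ℝ) : ℝ≥0∞ :=
  ⨅ (A : Algorithm n m) (_ : A.IsPAC ε δ), A.sampleComplexity

/-- The rate `((n - m) / ε ^ 2) * log ((n - m) / (n * δ))`. -/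
noncomputable def rate (n m : ℕ) (ε δ : ℝ) : ℝ :=
  ((n : ℝ) - m) / ε ^ 2 * Real.log (((n : ℝ) - m) / (n * δ))

end BestArmRetention

/-!
Write `k = n - m` and `x = k / (n δ)`, so that the rate is `k / ε ^ 2 * log x` and
`x ≥ 1 / (1 - β)` is bounded away from `1`.

**Lower bound.** On the instance in which all arms are fair coins, an algorithm that stops discards
exactly `k` arms. If arm `i` is replaced by a coin of bias `1 / 2 + ε`, it becomes the only
`ε`-optimal arm, hence it is discarded with probability at most `δ`. Let `Z` be the likelihood ratio
of the two instances, stopped together with the algorithm and truncated after `N` rounds, and let `D`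
be the event that arm `i` has been discarded. The inequality `log y ≤ y - 1`, applied to `x Z` on `D`
and to `Z` off `D`, gives `1 + log x * 1_D ≤ -log Z + Z + (x - 1) Z 1_D`. Integrating with respect to
the fair instance, where `Z` has mean `1`, `Z 1_D` has mean at most `δ`
(`Algorithm.lintegral_likelihood_discarded`), and `-log Z` has mean at most `3 ε ^ 2` times the
expected number of pulls of arm `i`, bounds the probability of `D`
(`Algorithm.IsPAC.log_mul_prob_discarded_le`). Summing over the arms and letting `N` tend to infinity
yields `k * (log x - 1 + 1 / x) ≤ 3 ε ^ 2 * E[T]`. Finally `log x - 1 + 1 / x` is at least a constant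
times `log x`, because `x` is bounded away from `1`.

**Upper bound.** Choose a cyclic interval of `k + 1` arms uniformly at random, find a good arm in it,
and keep this arm together with the `m - 1` arms outside the interval. This can fail only if the best
arm lies in the interval, which has probability `(k + 1) / n`; so the search may fail with probability
`d = n δ / (k + 1)`, and `log (1 / d)` is at most a constant times `log x`. The search is a knockout
tournament. Only the duels on the path of the best arm matter, so tolerances
`ε / 4 * (3 / 4) ^ l` and failure probabilities `d / 2 ^ (l + 1)` at height `l` suffice
(`expect_knockout_le`), and since `(4 / 3) ^ 2 < 2` the cost is dominated by the low heights, that is,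
proportional to the number of slots (`knockoutBudget_le`).

The tournament is described as a finite decision tree for binary rewards, whose probabilities are
finite sums. Comparing each reward with an independent uniform threshold turns it into a Bernoulli
bit with the same mean, which transfers these probabilities to every instance
(`prob_result_treeAlgorithm`).

Both halves rest on `measurePreserving_update_infinitePi`: the reward of a round may be replaced by a
fresh sample, and the past does not notice.
-/

namespace BestArmRetention

/-! ### Replacing one coordinate of a product measure by a fresh sample -/

section Resampling

/-- Resampling one coordinate independently preserves an infinite product measure. -/
theorem measurePreserving_update_infinitePi {ι : Type*} [DecidableEq ι] {X : ι → Type*}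
    [∀ i, MeasurableSpace (X i)] (μ : (i : ι) → Measure (X i)) [∀ i, IsProbabilityMeasure (μ i)]
    (i : ι) :
    MeasurePreserving (fun p : ((j : ι) → X j) × X i => Function.update p.1 i p.2)
      ((Measure.infinitePi μ).prod (μ i)) (Measure.infinitePi μ) := by
  have hm : Measurable (fun p : ((j : ι) → X j) × X i => Function.update p.1 i p.2) := by
    refine measurable_pi_lambda _ fun j => ?_
    by_cases h : j = i
    · subst h; simpa using measurable_snd
    · simp only [Function.update_of_ne h]; fun_prop
  refine ⟨hm, Measure.eq_infinitePi μ fun s t ht => ?_⟩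
  rw [Measure.map_apply hm (MeasurableSet.pi s.countable_toSet fun j _ => ht j)]
  by_cases hi : i ∈ s
  · have : (fun p : ((j : ι) → X j) × X i => Function.update p.1 i p.2) ⁻¹' (Set.pi s t)
        = (Set.pi (s.erase i : Finset ι) t) ×ˢ (t i) := by
      ext p
      simp only [Set.mem_preimage, Set.mem_pi, Set.mem_prod, Finset.mem_coe, Finset.mem_erase]
      constructor
      · intro h
        refine ⟨fun j hj => ?_, by simpa using h i hi⟩
        simpa [Function.update_of_ne hj.1] using h j hj.2
      · rintro ⟨h1, h2⟩ j hj
        by_cases hji : j = i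
        · subst hji; simpa using h2
        · simpa [Function.update_of_ne hji] using h1 j ⟨hji, hj⟩
    rw [this, Measure.prod_prod, Measure.infinitePi_pi μ (fun j _ => ht j),
      Finset.prod_erase_mul _ _ hi]
  · have : (fun p : ((j : ι) → X j) × X i => Function.update p.1 i p.2) ⁻¹' (Set.pi s t)
        = (Set.pi s t) ×ˢ Set.univ := by
      ext p
      simp only [Set.mem_preimage, Set.mem_pi, Set.mem_prod, Finset.mem_coe, Set.mem_univ, and_true]
      refine forall₂_congr fun j hj => ?_
      rw [Function.update_of_ne (by rintro rfl; exact hi hj)]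
    rw [this, Measure.prod_prod, Measure.infinitePi_pi μ (fun j _ => ht j), measure_univ, mul_one]

theorem lintegral_update_infinitePi {ι : Type*} [DecidableEq ι] {X : ι → Type*}
    [∀ i, MeasurableSpace (X i)] (μ : (i : ι) → Measure (X i)) [∀ i, IsProbabilityMeasure (μ i)]
    (i : ι) {f : ((j : ι) → X j) → ℝ≥0∞} (hf : Measurable f) :
    ∫⁻ x, f x ∂(Measure.infinitePi μ)
      = ∫⁻ x, ∫⁻ r, f (Function.update x i r) ∂(μ i) ∂(Measure.infinitePi μ) := by
  have h := measurePreserving_update_infinitePi μ i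
  rw [← h.lintegral_comp hf, 
    lintegral_prod (fun p => f (Function.update p.1 i p.2)) (hf.comp h.measurable).aemeasurable]

instance {n : ℕ} (ν : Instance n) : IsProbabilityMeasure ν.rewardLaw := by
  unfold Instance.rewardLaw; infer_instance

instance {n m : ℕ} (A : Algorithm n m) (ν : Instance n) : IsProbabilityMeasure (A.prob ν) := by
  unfold Algorithm.prob; infer_instance

theorem measurable_lintegral_law {n : ℕ} {Ω : Type*} [MeasurableSpace Ω] (ν : Instance n)
    {a : Ω → Fin n} (ha : Measurable a) {F : Ω → ℝ → ℝ≥0∞}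
    (hF : Measurable (Function.uncurry F)) : Measurable fun ω => ∫⁻ y, F ω y ∂(ν.law (a ω)) := by
  have hk : ∀ ω, ∫⁻ y, F ω y ∂(ν.law (a ω))
      = ∑ i, if a ω = i then ∫⁻ y, F ω y ∂(ν.law i) else 0 := by
    intro ω; simp
  simp_rw [hk]
  exact Finset.measurable_sum _ fun i _ => Measurable.ite (ha (measurableSet_singleton i))
    hF.lintegral_prod_right measurable_const

theorem measurable_apply_apply {n : ℕ} {Ω : Type*} [MeasurableSpace Ω]
    {a : Ω → Fin n} (ha : Measurable a) {y : Ω → Fin n → ℝ} (hy : Measurable y) :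
    Measurable fun ω => y ω (a ω) := by
  have h : Measurable fun p : (Fin n → ℝ) × Fin n => p.1 p.2 :=
    measurable_from_prod_countable_left fun i => by simpa using measurable_pi_apply i
  exact h.comp (hy.prodMk ha)

/-- If the arm `a` pulled in round `t` and the functional `F` do not depend on the rewards of round
`t`, then the observed reward may be replaced by a fresh sample of the law of that arm. -/
theorem lintegral_observed_reward {n : ℕ} {Z : Type*} [MeasurableSpace Z] (ζ : Measure Z)
    [SFinite ζ] (ν : Instance n) (t : ℕ) {a : Z × (ℕ → Fin n → ℝ) → Fin n} (ha : Measurable a)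
    (haa : ∀ z x r, a (z, Function.update x t r) = a (z, x))
    {F : Z × (ℕ → Fin n → ℝ) → ℝ → ℝ≥0∞} (hF : Measurable (Function.uncurry F))
    (hFa : ∀ z x r, F (z, Function.update x t r) = F (z, x)) :
    ∫⁻ ω, F ω (ω.2 t (a ω)) ∂(ζ.prod ν.rewardLaw)
      = ∫⁻ ω, ∫⁻ y, F ω y ∂(ν.law (a ω)) ∂(ζ.prod ν.rewardLaw) := by
  have hobs : Measurable fun ω : Z × (ℕ → Fin n → ℝ) => ω.2 t (a ω) :=
    measurable_apply_apply ha ((measurable_pi_apply t).comp measurable_snd)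
  have hm : Measurable fun ω : Z × (ℕ → Fin n → ℝ) => F ω (ω.2 t (a ω)) :=
    hF.comp (measurable_id.prodMk hobs)
  have hm2 := measurable_lintegral_law ν ha hF
  rw [lintegral_prod _ hm.aemeasurable, lintegral_prod _ hm2.aemeasurable]
  refine lintegral_congr fun z => ?_
  have hmz : Measurable fun x : ℕ → Fin n → ℝ => F (z, x) (x t (a (z, x))) :=
    hm.comp measurable_prodMk_left
  unfold Instance.rewardLaw
  rw [lintegral_update_infinitePi (fun _ : ℕ => Measure.pi ν.law) t hmz]
  refine lintegral_congr fun x => ?_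
  simp only [haa, hFa, Function.update_self]
  exact (measurePreserving_eval ν.law (a (z, x))).lintegral_comp
    (hF.comp measurable_prodMk_left)

end Resampling

/-! ### Histories and stopping times -/

section History

variable {n m : ℕ} (A : Algorithm n m)

/-- The history up to round `t` does not depend on the rewards of the later rounds. -/
theorem Algorithm.history_update (z : A.Seed) (x : ℕ → Fin n → ℝ) {s t : ℕ} (r : Fin n → ℝ)
    (h : s ≤ t) : A.history (z, Function.update x t r) s = A.history (z, x) s := by
  induction s with
  | zero => rfl
  | succ s ih =>
    simp only [Algorithm.history, ih (Nat.le_of_succ_le h)]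
    rw [Function.update_of_ne (by omega)]

/-- The arm pulled in round `t`. -/
def Algorithm.arm (t : ℕ) (ω : A.Outcome) : Fin n := A.pull t (ω.1, A.history ω t)

/-- The reward observed in round `t`. -/
def Algorithm.reward (t : ℕ) (ω : A.Outcome) : ℝ := ω.2 t (A.arm t ω)

theorem Algorithm.history_succ (t : ℕ) (ω : A.Outcome) :
    A.history ω (t + 1)
      = Fin.snoc (α := fun _ => Fin n × ℝ) (A.history ω t) (A.arm t ω, A.reward t ω) := rfl

theorem Algorithm.arm_update (z : A.Seed) (x : ℕ → Fin n → ℝ) {s t : ℕ} (r : Fin n → ℝ)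
    (h : s ≤ t) : A.arm s (z, Function.update x t r) = A.arm s (z, x) := by
  simp only [Algorithm.arm, A.history_update z x r h]

theorem Algorithm.reward_update (z : A.Seed) (x : ℕ → Fin n → ℝ) {s t : ℕ} (r : Fin n → ℝ)
    (h : s < t) : A.reward s (z, Function.update x t r) = A.reward s (z, x) := by
  simp only [Algorithm.reward, A.arm_update z x r h.le, Function.update_of_ne h.ne]

theorem measurable_snoc_history (t : ℕ) :
    Measurable fun p : History n t × (Fin n × ℝ) =>
      (Fin.snoc (α := fun _ => Fin n × ℝ) p.1 p.2 : History n (t + 1)) := by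
  refine measurable_pi_lambda _ fun j => ?_
  refine Fin.lastCases ?_ (fun j => ?_) j
  · simpa using measurable_snd
  · simp only [Fin.snoc_castSucc]; fun_prop

theorem Algorithm.measurable_history (t : ℕ) : Measurable fun ω : A.Outcome => A.history ω t := by
  induction t with
  | zero => exact measurable_pi_lambda _ fun j => j.elim0
  | succ t ih =>
    have ha : Measurable (A.arm t) := (A.measurable_pull t).comp (measurable_fst.prodMk ih)
    have hr : Measurable (A.reward t) :=
      measurable_apply_apply ha ((measurable_pi_apply t).comp measurable_snd)
    exact (measurable_snoc_history t).comp (ih.prodMk (ha.prodMk hr))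

theorem Algorithm.measurable_arm (t : ℕ) : Measurable (A.arm t) :=
  (A.measurable_pull t).comp (measurable_fst.prodMk (A.measurable_history t))

theorem Algorithm.measurable_reward (t : ℕ) : Measurable (A.reward t) :=
  measurable_apply_apply (A.measurable_arm t) ((measurable_pi_apply t).comp measurable_snd)

/-- The algorithm has not stopped before round `t`, that is, `T ≥ t`. -/
def Algorithm.Alive (t : ℕ) (ω : A.Outcome) : Prop :=
  ∀ s < t, A.halt s (ω.1, A.history ω s) = false

theorem Algorithm.alive_zero (ω : A.Outcome) : A.Alive 0 ω := fun s hs => absurd hs (by omega)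

theorem Algorithm.alive_succ (t : ℕ) (ω : A.Outcome) :
    A.Alive (t + 1) ω ↔ A.Alive t ω ∧ A.halt t (ω.1, A.history ω t) = false := by
  constructor
  · exact fun h => ⟨fun s hs => h s (by omega), h t (by omega)⟩
  · rintro ⟨h1, h2⟩ s hs
    rcases Nat.lt_succ_iff_lt_or_eq.mp hs with h | rfl
    · exact h1 s h
    · exact h2

theorem Algorithm.alive_update (z : A.Seed) (x : ℕ → Fin n → ℝ) {s t : ℕ} (r : Fin n → ℝ)
    (h : s ≤ t + 1) : A.Alive s (z, Function.update x t r) ↔ A.Alive s (z, x) := by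
  refine forall₂_congr fun s' hs' => ?_
  simp only [A.history_update z x r (show s' ≤ t by omega)]

theorem Algorithm.measurable_halt_history (t : ℕ) :
    Measurable fun ω : A.Outcome => A.halt t (ω.1, A.history ω t) :=
  (A.measurable_halt t).comp (measurable_fst.prodMk (A.measurable_history t))

theorem Algorithm.measurableSet_alive (t : ℕ) : MeasurableSet {ω | A.Alive t ω} := by
  simp only [Algorithm.Alive, Set.ofPred_forall]
  exact MeasurableSet.iInter fun s => MeasurableSet.iInter fun _ =>
    A.measurable_halt_history s (measurableSet_singleton false)

/-- `T = t` means that the algorithm has not stopped before round `t` and stops then. -/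
theorem Algorithm.samples_eq_iff (t : ℕ) (ω : A.Outcome) :
    A.samples ω = t ↔ A.Alive t ω ∧ A.halt t (ω.1, A.history ω t) = true := by
  unfold Algorithm.samples
  constructor
  · intro h
    have hlt : A.Alive t ω := by
      intro s hs
      by_contra hc
      have : (⨅ (t : ℕ) (_ : A.halt t (ω.1, A.history ω t) = true), (t : ℕ∞)) ≤ (s : ℕ∞) :=
        iInf₂_le s (by simpa using hc)
      rw [h] at this
      exact absurd (Nat.cast_le.mp this) (by omega)
    refine ⟨hlt, ?_⟩
    by_contra hc
    have : ((t + 1 : ℕ) : ℕ∞)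
        ≤ ⨅ (t : ℕ) (_ : A.halt t (ω.1, A.history ω t) = true), (t : ℕ∞) := by
      refine le_iInf₂ fun s hs => Nat.cast_le.mpr ?_
      by_contra hlt'
      have h2 : A.Alive (t + 1) ω := (A.alive_succ t ω).2 ⟨hlt, by simpa using hc⟩
      have := h2 s (by omega)
      simp [hs] at this
    rw [h] at this
    exact absurd (Nat.cast_le.mp this) (by omega)
  · rintro ⟨h1, h2⟩
    refine le_antisymm (iInf₂_le t h2) (le_iInf₂ fun s hs => Nat.cast_le.mpr ?_)
    by_contra hlt
    have := h1 s (by omega)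
    simp [hs] at this

theorem Algorithm.alive_iff_le_samples (t : ℕ) (ω : A.Outcome) :
    A.Alive t ω ↔ (t : ℕ∞) ≤ A.samples ω := by
  unfold Algorithm.samples
  constructor
  · refine fun h => le_iInf₂ fun s hs => Nat.cast_le.mpr ?_
    by_contra hlt
    have := h s (by omega)
    simp [hs] at this
  · intro h s hs
    by_contra hc
    have h2 : (t : ℕ∞) ≤ s := h.trans (iInf₂_le s (by simpa using hc))
    exact absurd (Nat.cast_le.mp h2) (by omega)

end History

/-! ### Bernoulli instances -/

section Bernoulli

/-- The Bernoulli distribution with success probability `p`, as a law on the real line. -/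
noncomputable def bernoulliLaw (p : ℝ) : Measure ℝ :=
  ENNReal.ofReal (1 - p) • Measure.dirac 0 + ENNReal.ofReal p • Measure.dirac 1

theorem lintegral_bernoulliLaw (p : ℝ) (f : ℝ → ℝ≥0∞) :
    ∫⁻ y, f y ∂(bernoulliLaw p) = ENNReal.ofReal (1 - p) * f 0 + ENNReal.ofReal p * f 1 := by
  simp [bernoulliLaw, lintegral_dirac]

/-- The instance whose arm `i` is Bernoulli with mean `p i`. -/
noncomputable def bernoulliInstance {n : ℕ} (p : Fin n → unitInterval) : Instance n where
  law i := bernoulliLaw (p i)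
  isProb i := ⟨by
    rw [← lintegral_one, lintegral_bernoulliLaw, mul_one, mul_one,
      ← ENNReal.ofReal_add (by linarith [(p i).2.2]) (p i).2.1]
    simp⟩
  supp i := by
    have h0 : ∀ᵐ x ∂(Measure.dirac (0 : ℝ)), x ∈ Set.Icc (0 : ℝ) 1 := by
      simp [ae_dirac_eq]
    have h1 : ∀ᵐ x ∂(Measure.dirac (1 : ℝ)), x ∈ Set.Icc (0 : ℝ) 1 := by
      simp [ae_dirac_eq]
    unfold bernoulliLaw
    rw [ae_add_measure_iff]
    exact ⟨Measure.ae_smul_measure h0 _, Measure.ae_smul_measure h1 _⟩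

theorem mean_bernoulliInstance {n : ℕ} (p : Fin n → unitInterval) (i : Fin n) :
    (bernoulliInstance p).mean i = p i := by
  have h0 : Integrable (fun x : ℝ => x) (ENNReal.ofReal (1 - p i) • Measure.dirac (0 : ℝ)) :=
    (integrable_dirac (by simp)).smul_measure ENNReal.ofReal_ne_top
  have h1 : Integrable (fun x : ℝ => x) (ENNReal.ofReal (p i) • Measure.dirac (1 : ℝ)) :=
    (integrable_dirac (by simp)).smul_measure ENNReal.ofReal_ne_top
  simp only [Instance.mean, bernoulliInstance, bernoulliLaw]
  rw [integral_add_measure h0 h1, integral_smul_measure, integral_smul_measure, integral_dirac,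
    integral_dirac, ENNReal.toReal_ofReal (p i).2.1]
  simp

/-- Success probabilities of the instance in which all arms are fair, except that arm `i` has
success probability `1 / 2 + ε`. -/
noncomputable def biasedMeans {n : ℕ} (i : Fin n) {ε : ℝ} (h0 : 0 < ε) (h1 : ε ≤ 1 / 8) :
    Fin n → unitInterval :=
  fun j => if j = i then ⟨1 / 2 + ε, by linarith, by linarith⟩ else ⟨1 / 2, by norm_num, by norm_num⟩

/-- The instance in which all arms are fair coins. -/
noncomputable def fairInstance (n : ℕ) : Instance n :=
  bernoulliInstance fun _ => ⟨1 / 2, by norm_num, by norm_num⟩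

/-- The instance in which arm `i` has mean `1 / 2 + ε` and all other arms are fair coins. -/
noncomputable def biasedInstance {n : ℕ} (i : Fin n) {ε : ℝ} (h0 : 0 < ε) (h1 : ε ≤ 1 / 8) :
    Instance n :=
  bernoulliInstance (biasedMeans i h0 h1)

theorem eq_of_isEpsOptimal_biasedInstance {n : ℕ} {i j : Fin n} {ε : ℝ} (h0 : 0 < ε)
    (h1 : ε ≤ 1 / 8) (h : (biasedInstance i h0 h1).IsEpsOptimal ε j) : j = i := by
  by_contra hji
  have := h i
  rw [biasedInstance, mean_bernoulliInstance, mean_bernoulliInstance] at this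
  simp [biasedMeans, hji] at this

end Bernoulli

/-! ### Stopped likelihood ratios -/

section Likelihood

variable {n m : ℕ} (A : Algorithm n m)

theorem Algorithm.lintegral_reward_bernoulliInstance (p : Fin n → unitInterval) (t : ℕ)
    {F : A.Outcome → ℝ → ℝ≥0∞} (hF : Measurable (Function.uncurry F))
    (hFa : ∀ z x r, F (z, Function.update x t r) = F (z, x)) :
    ∫⁻ ω, F ω (A.reward t ω) ∂(A.prob (bernoulliInstance p))
      = ∫⁻ ω, (ENNReal.ofReal (1 - p (A.arm t ω)) * F ω 0 + ENNReal.ofReal (p (A.arm t ω)) * F ω 1)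
          ∂(A.prob (bernoulliInstance p)) := by
  unfold Algorithm.prob Algorithm.reward
  rw [lintegral_observed_reward A.seedLaw (bernoulliInstance p) t (A.measurable_arm t)
    (fun z x r => A.arm_update z x r le_rfl) hF hFa]
  exact lintegral_congr fun ω => lintegral_bernoulliLaw _ _

theorem Algorithm.lintegral_reward_fairInstance (t : ℕ)
    {F : A.Outcome → ℝ → ℝ≥0∞} (hF : Measurable (Function.uncurry F))
    (hFa : ∀ z x r, F (z, Function.update x t r) = F (z, x)) :
    ∫⁻ ω, F ω (A.reward t ω) ∂(A.prob (fairInstance n))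
      = ∫⁻ ω, ENNReal.ofReal (1 / 2) * (F ω 0 + F ω 1) ∂(A.prob (fairInstance n)) := by
  unfold fairInstance
  rw [A.lintegral_reward_bernoulliInstance _ t hF hFa]
  refine lintegral_congr fun ω => ?_
  rw [mul_add]
  norm_num

open scoped Classical in
/-- The likelihood ratio of the observation `y` of round `t` between the instance in which arm `i`
is biased and the fair instance. It is `1` once the algorithm has stopped. -/
noncomputable def Algorithm.roundRatio (i : Fin n) (ε : ℝ) (t : ℕ) (ω : A.Outcome) (y : ℝ) : ℝ :=
  if A.Alive (t + 1) ω ∧ A.arm t ω = i then (if y = 1 then 1 + 2 * ε else 1 - 2 * ε) else 1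

/-- The likelihood ratio of the first `t` rounds, stopped when the algorithm stops. -/
noncomputable def Algorithm.likelihood (i : Fin n) (ε : ℝ) (t : ℕ) (ω : A.Outcome) : ℝ :=
  ∏ s ∈ Finset.range t, A.roundRatio i ε s ω (A.reward s ω)

/-- Before round `t` the algorithm has stopped and discarded arm `i`. -/
def Algorithm.Discarded (i : Fin n) (t : ℕ) (ω : A.Outcome) : Prop :=
  ∃ s < t, A.Alive s ω ∧ A.halt s (ω.1, A.history ω s) = true ∧
    i ∉ A.retain s (ω.1, A.history ω s)

variable {A}

theorem Algorithm.roundRatio_mem (i : Fin n) {ε : ℝ} (h0 : 0 < ε) (h1 : ε ≤ 1 / 8) (t : ℕ)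
    (ω : A.Outcome) (y : ℝ) : A.roundRatio i ε t ω y ∈ Set.Icc (1 / 2 : ℝ) 2 := by
  unfold Algorithm.roundRatio
  split_ifs <;> constructor <;> linarith

theorem Algorithm.roundRatio_update (i : Fin n) (ε : ℝ) {s t : ℕ} (h : s ≤ t) (z : A.Seed)
    (x : ℕ → Fin n → ℝ) (r : Fin n → ℝ) :
    A.roundRatio i ε s (z, Function.update x t r) = A.roundRatio i ε s (z, x) := by
  funext y
  unfold Algorithm.roundRatio
  congr 1
  rw [A.arm_update z x r h, A.alive_update z x r (show s + 1 ≤ t + 1 by omega)]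

theorem Algorithm.likelihood_update (i : Fin n) (ε : ℝ) (t : ℕ) (z : A.Seed)
    (x : ℕ → Fin n → ℝ) (r : Fin n → ℝ) :
    A.likelihood i ε t (z, Function.update x t r) = A.likelihood i ε t (z, x) := by
  refine Finset.prod_congr rfl fun s hs => ?_
  rw [Finset.mem_range] at hs
  rw [Algorithm.roundRatio_update i ε hs.le, A.reward_update z x r hs]

theorem Algorithm.likelihood_succ (i : Fin n) (ε : ℝ) (t : ℕ) (ω : A.Outcome) :
    A.likelihood i ε (t + 1) ω
      = A.likelihood i ε t ω * A.roundRatio i ε t ω (A.reward t ω) :=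
  Finset.prod_range_succ _ _

theorem Algorithm.likelihood_pos (i : Fin n) {ε : ℝ} (h0 : 0 < ε) (h1 : ε ≤ 1 / 8) (t : ℕ)
    (ω : A.Outcome) : 0 < A.likelihood i ε t ω :=
  Finset.prod_pos fun s _ => lt_of_lt_of_le (by norm_num)
    (Algorithm.roundRatio_mem i h0 h1 s ω _).1

theorem Algorithm.measurable_roundRatio (i : Fin n) (ε : ℝ) (t : ℕ) :
    Measurable (Function.uncurry (A.roundRatio i ε t)) := by
  refine Measurable.ite ?_ ?_ measurable_const
  · exact measurable_fst
      ((A.measurableSet_alive (t + 1)).inter (A.measurable_arm t (measurableSet_singleton i)))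
  · exact Measurable.ite (measurable_snd (measurableSet_singleton 1)) measurable_const
      measurable_const

theorem Algorithm.measurable_likelihood (i : Fin n) (ε : ℝ) (t : ℕ) :
    Measurable (A.likelihood i ε t) :=
  Finset.measurable_prod _ fun s _ => (Algorithm.measurable_roundRatio i ε s).comp
    (measurable_id.prodMk (A.measurable_reward s))

theorem Algorithm.discarded_succ (i : Fin n) (t : ℕ) (ω : A.Outcome) :
    A.Discarded i (t + 1) ω ↔ A.Discarded i t ω ∨ (A.Alive t ω ∧
      A.halt t (ω.1, A.history ω t) = true ∧ i ∉ A.retain t (ω.1, A.history ω t)) := by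
  constructor
  · rintro ⟨s, hs, h⟩
    rcases Nat.lt_succ_iff_lt_or_eq.mp hs with h' | rfl
    · exact Or.inl ⟨s, h', h⟩
    · exact Or.inr h
  · rintro (⟨s, hs, h⟩ | h)
    · exact ⟨s, by omega, h⟩
    · exact ⟨t, by omega, h⟩

theorem Algorithm.Discarded.not_alive {i : Fin n} {t : ℕ} {ω : A.Outcome}
    (h : A.Discarded i t ω) : ¬ A.Alive t ω := by
  obtain ⟨s, hs, _, h2, _⟩ := h
  intro ha
  simp [ha s hs] at h2

theorem Algorithm.measurableSet_retain_history (i : Fin n) (t : ℕ) :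
    MeasurableSet {p : A.Seed × History n t | i ∉ A.retain t p} := by
  have : {p : A.Seed × History n t | i ∉ A.retain t p}
      = ⋃ S : Finset (Fin n), ⋃ _ : i ∉ S, {p | A.retain t p = S} := by
    ext p; simp
  rw [this]
  exact MeasurableSet.iUnion fun S => MeasurableSet.iUnion fun _ => A.measurable_retain t S

theorem Algorithm.measurableSet_discarded (i : Fin n) (t : ℕ) :
    MeasurableSet {ω | A.Discarded i t ω} := by
  induction t with
  | zero => simp [Algorithm.Discarded]
  | succ t ih =>
    simp only [Algorithm.discarded_succ]
    refine ih.union ((A.measurableSet_alive t).inter (MeasurableSet.inter ?_ ?_))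
    · exact A.measurable_halt_history t (measurableSet_singleton true)
    · exact (measurable_fst.prodMk (A.measurable_history t))
        (Algorithm.measurableSet_retain_history i t)

open scoped Classical in
/-- Change of measure on the event that the algorithm runs for at least `t` rounds. -/
theorem Algorithm.lintegral_alive_biasedInstance (i : Fin n) {ε : ℝ} (h0 : 0 < ε) (h1 : ε ≤ 1 / 8)
    (t : ℕ) {g : A.Seed × History n t → ℝ≥0∞} (hg : Measurable g) :
    ∫⁻ ω, (if A.Alive t ω then g (ω.1, A.history ω t) else 0) ∂(A.prob (biasedInstance i h0 h1))
      = ∫⁻ ω, ENNReal.ofReal (A.likelihood i ε t ω) *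
          (if A.Alive t ω then g (ω.1, A.history ω t) else 0) ∂(A.prob (fairInstance n)) := by
  induction t with
  | zero =>
    have hfst : ∀ ν : Instance n, Measure.map Prod.fst (A.prob ν) = A.seedLaw := fun ν => by
      simp [Algorithm.prob]
    have key : ∀ ν : Instance n,
        ∫⁻ ω, (if A.Alive 0 ω then g (ω.1, A.history ω 0) else 0) ∂(A.prob ν)
          = ∫⁻ z, g (z, Fin.elim0) ∂A.seedLaw := fun ν => by
      rw [← hfst ν, lintegral_map (f := fun z => g (z, Fin.elim0))
        (hg.comp (measurable_id.prodMk measurable_const)) measurable_fst]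
      exact lintegral_congr fun ω => by rw [if_pos (A.alive_zero ω)]; rfl
    rw [key, ← key (fairInstance n)]
    simp [Algorithm.likelihood]
  | succ t ih =>
    set p := biasedMeans i h0 h1 with hp
    let F : A.Outcome → ℝ → ℝ≥0∞ := fun ω y => if A.Alive (t + 1) ω then
      g (ω.1, Fin.snoc (α := fun _ => Fin n × ℝ) (A.history ω t) (A.arm t ω, y)) else 0
    have hFm : Measurable (Function.uncurry F) := by
      refine Measurable.ite (measurable_fst (A.measurableSet_alive (t + 1))) ?_ measurable_const
      have hp : Measurable fun q : A.Outcome × ℝ => (A.history q.1 t, A.arm t q.1, q.2) :=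
        ((A.measurable_history t).comp measurable_fst).prodMk
          (((A.measurable_arm t).comp measurable_fst).prodMk measurable_snd)
      exact hg.comp ((measurable_fst.comp measurable_fst).prodMk
        ((measurable_snoc_history t).comp hp))
    have hFa : ∀ z x r, F (z, Function.update x t r) = F (z, x) := fun z x r => by
      funext y
      simp only [F, A.alive_update z x r le_rfl, A.history_update z x r le_rfl,
        A.arm_update z x r le_rfl]
    let g' : A.Seed × History n t → ℝ≥0∞ := fun q => if A.halt t q = false then
      ENNReal.ofReal (1 - p (A.pull t q)) *
          g (q.1, Fin.snoc (α := fun _ => Fin n × ℝ) q.2 (A.pull t q, 0)) +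
        ENNReal.ofReal (p (A.pull t q)) *
          g (q.1, Fin.snoc (α := fun _ => Fin n × ℝ) q.2 (A.pull t q, 1)) else 0
    have hsn : ∀ c : ℝ, Measurable fun q : A.Seed × History n t =>
        g (q.1, Fin.snoc (α := fun _ => Fin n × ℝ) q.2 (A.pull t q, c)) := fun c =>
      hg.comp (measurable_fst.prodMk ((measurable_snoc_history t).comp
        (measurable_snd.prodMk ((A.measurable_pull t).prodMk measurable_const))))
    have hg' : Measurable g' := by
      refine Measurable.ite (A.measurable_halt t (measurableSet_singleton false)) ?_
        measurable_const
      refine Measurable.add (Measurable.mul ?_ (hsn 0)) (Measurable.mul ?_ (hsn 1))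
      · exact (measurable_of_finite fun a => ENNReal.ofReal (1 - p a)).comp (A.measurable_pull t)
      · exact (measurable_of_finite fun a => ENNReal.ofReal (p a)).comp (A.measurable_pull t)
    have hL : ∫⁻ ω, (if A.Alive (t + 1) ω then g (ω.1, A.history ω (t + 1)) else 0)
          ∂(A.prob (biasedInstance i h0 h1))
        = ∫⁻ ω, (if A.Alive t ω then g' (ω.1, A.history ω t) else 0)
          ∂(A.prob (biasedInstance i h0 h1)) := by
      refine (A.lintegral_reward_bernoulliInstance p t hFm hFa).trans
        (lintegral_congr fun ω => ?_)
      simp only [F, g', A.alive_succ t ω]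
      by_cases ha : A.Alive t ω <;> by_cases hh : A.halt t (ω.1, A.history ω t) = false <;>
        simp [ha, hh, Algorithm.arm]
    rw [hL, ih hg']
    let G : A.Outcome → ℝ → ℝ≥0∞ := fun ω y => ENNReal.ofReal (A.likelihood i ε t ω) *
      ENNReal.ofReal (A.roundRatio i ε t ω y) * F ω y
    have hGm : Measurable (Function.uncurry G) :=
      ((((Algorithm.measurable_likelihood i ε t).comp measurable_fst).ennreal_ofReal).mul
        (Algorithm.measurable_roundRatio i ε t).ennreal_ofReal).mul hFm
    have hGa : ∀ z x r, G (z, Function.update x t r) = G (z, x) := fun z x r => by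
      funext y
      simp only [G, hFa, Algorithm.likelihood_update, Algorithm.roundRatio_update i ε le_rfl]
    have hR : ∫⁻ ω, ENNReal.ofReal (A.likelihood i ε (t + 1) ω) *
          (if A.Alive (t + 1) ω then g (ω.1, A.history ω (t + 1)) else 0) ∂(A.prob (fairInstance n))
        = ∫⁻ ω, G ω (A.reward t ω) ∂(A.prob (fairInstance n)) := by
      refine lintegral_congr fun ω => ?_
      rw [Algorithm.likelihood_succ,
        ENNReal.ofReal_mul (Algorithm.likelihood_pos i h0 h1 t ω).le]
      rfl
    rw [hR, A.lintegral_reward_fairInstance t hGm hGa]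
    refine lintegral_congr fun ω => ?_
    simp only [G, F, g', A.alive_succ t ω, Algorithm.roundRatio, Algorithm.arm]
    by_cases ha : A.Alive t ω
    swap
    · simp [ha]
    by_cases hh : A.halt t (ω.1, A.history ω t) = false
    swap
    · simp [ha, hh]
    simp only [ha, hh, and_self, if_true, true_and]
    have e0 : ENNReal.ofReal (1 / 2) * ENNReal.ofReal (1 - 2 * ε) = ENNReal.ofReal (1 / 2 - ε) := by
      rw [← ENNReal.ofReal_mul (by norm_num)]; congr 1; ring
    have e1 : ENNReal.ofReal (1 / 2) * ENNReal.ofReal (1 + 2 * ε) = ENNReal.ofReal (1 / 2 + ε) := by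
      rw [← ENNReal.ofReal_mul (by norm_num)]; congr 1; ring
    by_cases hi : A.pull t (ω.1, A.history ω t) = i
    · have p0 : ENNReal.ofReal (1 - (p (A.pull t (ω.1, A.history ω t)) : ℝ))
          = ENNReal.ofReal (1 / 2 - ε) := by
        simp only [hp, biasedMeans, hi, if_true]; congr 1; ring
      have p1 : ENNReal.ofReal (p (A.pull t (ω.1, A.history ω t)) : ℝ)
          = ENNReal.ofReal (1 / 2 + ε) := by
        simp only [hp, biasedMeans, hi, if_true]
      rw [p0, p1, ← e0, ← e1]
      simp only [hi, if_true, zero_ne_one, if_false]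
      ring
    · have p0 : ENNReal.ofReal (1 - (p (A.pull t (ω.1, A.history ω t)) : ℝ))
          = ENNReal.ofReal (1 / 2) := by
        simp only [hp, biasedMeans, hi, if_false]; congr 1; ring
      have p1 : ENNReal.ofReal (p (A.pull t (ω.1, A.history ω t)) : ℝ)
          = ENNReal.ofReal (1 / 2) := by
        simp only [hp, biasedMeans, hi, if_false]
      rw [p0, p1]
      simp only [hi, if_false, ENNReal.ofReal_one]
      ring

/-- The stopped likelihood ratio has mean `1` on the fair instance: in each round it is multiplied by
a factor of conditional mean `1`. -/
theorem Algorithm.lintegral_likelihood (i : Fin n) {ε : ℝ} (h0 : 0 < ε) (h1 : ε ≤ 1 / 8) (t : ℕ) :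
    ∫⁻ ω, ENNReal.ofReal (A.likelihood i ε t ω) ∂(A.prob (fairInstance n)) = 1 := by
  induction t with
  | zero => simp [Algorithm.likelihood]
  | succ t ih =>
    let G : A.Outcome → ℝ → ℝ≥0∞ := fun ω y => ENNReal.ofReal (A.likelihood i ε t ω) *
      ENNReal.ofReal (A.roundRatio i ε t ω y)
    have hGm : Measurable (Function.uncurry G) :=
      (((Algorithm.measurable_likelihood i ε t).comp measurable_fst).ennreal_ofReal).mul
        (Algorithm.measurable_roundRatio i ε t).ennreal_ofReal
    have hGa : ∀ z x r, G (z, Function.update x t r) = G (z, x) := fun z x r => by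
      funext y
      simp only [G, Algorithm.likelihood_update, Algorithm.roundRatio_update i ε le_rfl]
    have hR : ∫⁻ ω, ENNReal.ofReal (A.likelihood i ε (t + 1) ω) ∂(A.prob (fairInstance n))
        = ∫⁻ ω, G ω (A.reward t ω) ∂(A.prob (fairInstance n)) := by
      refine lintegral_congr fun ω => ?_
      rw [Algorithm.likelihood_succ,
        ENNReal.ofReal_mul (Algorithm.likelihood_pos i h0 h1 t ω).le]
    rw [hR, A.lintegral_reward_fairInstance t hGm hGa, ← ih]
    refine lintegral_congr fun ω => ?_
    have hpos : ∀ y, 0 ≤ A.roundRatio i ε t ω y := fun y =>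
      le_trans (by norm_num) (Algorithm.roundRatio_mem i h0 h1 t ω y).1
    simp only [G]
    rw [← mul_add, ← ENNReal.ofReal_add (hpos 0) (hpos 1), mul_left_comm,
      ← ENNReal.ofReal_mul (by norm_num)]
    have : 1 / 2 * (A.roundRatio i ε t ω 0 + A.roundRatio i ε t ω 1) = 1 := by
      unfold Algorithm.roundRatio
      split_ifs <;> norm_num at *
    rw [this, ENNReal.ofReal_one, mul_one]

open scoped Classical in
/-- Change of measure on the event that arm `i` has been discarded. After stopping the likelihood
ratio is constant, so the event may be split according to the round in which the algorithm stops. -/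
theorem Algorithm.lintegral_likelihood_discarded (i : Fin n) {ε : ℝ} (h0 : 0 < ε) (h1 : ε ≤ 1 / 8)
    (t : ℕ) :
    ∫⁻ ω, ENNReal.ofReal (A.likelihood i ε t ω) * (if A.Discarded i t ω then 1 else 0)
        ∂(A.prob (fairInstance n))
      = A.prob (biasedInstance i h0 h1) {ω | A.Discarded i t ω} := by
  induction t with
  | zero => simp [Algorithm.Discarded]
  | succ t ih =>
    let g : A.Seed × History n t → ℝ≥0∞ := fun q =>
      if A.halt t q = true ∧ i ∉ A.retain t q then 1 else 0
    have hg : Measurable g := Measurable.ite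
      ((A.measurable_halt t (measurableSet_singleton true)).inter
        (Algorithm.measurableSet_retain_history i t)) measurable_const measurable_const
    have hsplit : ∀ ω : A.Outcome, (if A.Discarded i (t + 1) ω then (1 : ℝ≥0∞) else 0)
        = (if A.Discarded i t ω then 1 else 0)
          + (if A.Alive t ω then g (ω.1, A.history ω t) else 0) := by
      intro ω
      rw [A.discarded_succ]
      by_cases hd : A.Discarded i t ω
      · simp [hd, hd.not_alive]
      · by_cases ha : A.Alive t ω <;> simp [hd, ha, g]
    have hm : Measurable fun ω : A.Outcome => if A.Discarded i t ω then (1 : ℝ≥0∞) else 0 :=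
      Measurable.ite (Algorithm.measurableSet_discarded i t) measurable_const measurable_const
    have hprob : ∀ s, A.prob (biasedInstance i h0 h1) {ω | A.Discarded i s ω}
        = ∫⁻ ω, (if A.Discarded i s ω then 1 else 0) ∂(A.prob (biasedInstance i h0 h1)) := by
      intro s
      rw [← lintegral_indicator_one (Algorithm.measurableSet_discarded i s)]
      exact lintegral_congr fun ω => by simp [Set.indicator_apply]
    have hlik : ∀ ω : A.Outcome, ENNReal.ofReal (A.likelihood i ε (t + 1) ω) *
          (if A.Discarded i (t + 1) ω then 1 else 0)
        = ENNReal.ofReal (A.likelihood i ε t ω) * (if A.Discarded i t ω then 1 else 0)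
          + ENNReal.ofReal (A.likelihood i ε t ω) *
            (if A.Alive t ω then g (ω.1, A.history ω t) else 0) := by
      intro ω
      rw [← mul_add, ← hsplit]
      by_cases hd : A.Discarded i (t + 1) ω
      · rw [Algorithm.likelihood_succ, Algorithm.roundRatio, if_neg, mul_one]
        exact fun h => hd.not_alive h.1
      · simp [hd]
    simp_rw [hlik, hprob, hsplit]
    rw [lintegral_add_left, lintegral_add_left hm, ih, hprob,
      Algorithm.lintegral_alive_biasedInstance i h0 h1 t hg]
    exact (Algorithm.measurable_likelihood i ε t).ennreal_ofReal.mul hm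

/-- When arm `i` is biased it is the only `ε`-optimal arm, so discarding it is a failure. -/
theorem Algorithm.IsPAC.prob_discarded_le {ε δ : ℝ} (hA : A.IsPAC ε δ) (i : Fin n) (h0 : 0 < ε)
    (h1 : ε ≤ 1 / 8) (t : ℕ) :
    A.prob (biasedInstance i h0 h1) {ω | A.Discarded i t ω} ≤ ENNReal.ofReal δ := by
  set P := A.prob (biasedInstance i h0 h1)
  have hsub : {ω | A.Succeeds (biasedInstance i h0 h1) ε ω} ⊆ {ω | A.Discarded i t ω}ᶜ := by
    rintro ω ⟨s, hs, j, hj, hopt⟩ ⟨s', -, ha, hh, hi⟩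
    have := eq_of_isEpsOptimal_biasedInstance h0 h1 hopt
    subst this
    have hs' := (A.samples_eq_iff s' ω).2 ⟨ha, hh⟩
    rw [hs, Nat.cast_inj] at hs'
    subst hs'
    exact hi hj
  have h2 := (hA (biasedInstance i h0 h1)).trans (measure_mono hsub)
  have h3 := prob_add_prob_compl (μ := P) (Algorithm.measurableSet_discarded (A := A) i t)
  have h4 : P {ω | A.Discarded i t ω} + ENNReal.ofReal (1 - δ)
      ≤ ENNReal.ofReal δ + ENNReal.ofReal (1 - δ) :=
    calc _ ≤ 1 := by rw [← h3]; gcongr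
      _ = ENNReal.ofReal (δ + (1 - δ)) := by simp
      _ ≤ _ := ENNReal.ofReal_add_le
  exact (ENNReal.add_le_add_iff_right ENNReal.ofReal_ne_top).1 h4

end Likelihood

/-! ### The lower bound -/

section LowerBound

variable {n m : ℕ} {A : Algorithm n m}

theorem Algorithm.prob_pull_and_reward_eq_one (i : Fin n) (t : ℕ) :
    (A.prob (fairInstance n)).real
        ({ω | A.Alive (t + 1) ω ∧ A.arm t ω = i} ∩ {ω | A.reward t ω = 1})
      = 1 / 2 * (A.prob (fairInstance n)).real {ω | A.Alive (t + 1) ω ∧ A.arm t ω = i} := by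
  classical
  set B := {ω | A.Alive (t + 1) ω ∧ A.arm t ω = i} with hB
  have hBm : MeasurableSet B :=
    (A.measurableSet_alive (t + 1)).inter (A.measurable_arm t (measurableSet_singleton i))
  let F : A.Outcome → ℝ → ℝ≥0∞ := fun ω y => if ω ∈ B ∧ y = 1 then 1 else 0
  have hF : Measurable (Function.uncurry F) := Measurable.ite
    ((measurable_fst hBm).inter (measurable_snd (measurableSet_singleton 1)))
    measurable_const measurable_const
  have hFa : ∀ z x r, F (z, Function.update x t r) = F (z, x) := fun z x r => by
    funext y
    have : ((z, Function.update x t r) ∈ B) = ((z, x) ∈ B) := by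
      simp only [hB, Set.mem_ofPred_eq, A.alive_update z x r le_rfl, A.arm_update z x r le_rfl]
    simp only [F, this]
  have h := A.lintegral_reward_fairInstance t hF hFa
  have hl : ∫⁻ ω, F ω (A.reward t ω) ∂(A.prob (fairInstance n))
      = A.prob (fairInstance n) (B ∩ {ω | A.reward t ω = 1}) := by
    have hR : MeasurableSet {ω | A.reward t ω = 1} :=
      A.measurable_reward t (measurableSet_singleton 1)
    rw [← lintegral_indicator_one (hBm.inter hR)]
    exact lintegral_congr fun ω => by simp [F, Set.indicator_apply]
  have hr : ∫⁻ ω, ENNReal.ofReal (1 / 2) * (F ω 0 + F ω 1) ∂(A.prob (fairInstance n))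
      = ENNReal.ofReal (1 / 2) * A.prob (fairInstance n) B := by
    rw [lintegral_const_mul' _ _ ENNReal.ofReal_ne_top, ← lintegral_indicator_one hBm]
    congr 1
    exact lintegral_congr fun ω => by simp [F, Set.indicator_apply]
  rw [hl, hr] at h
  rw [measureReal_def, h, ENNReal.toReal_mul, ENNReal.toReal_ofReal (by norm_num)]
  rfl

theorem Algorithm.measurableSet_alive_arm (i : Fin n) (t : ℕ) :
    MeasurableSet {ω | A.Alive (t + 1) ω ∧ A.arm t ω = i} :=
  (A.measurableSet_alive (t + 1)).inter (A.measurable_arm t (measurableSet_singleton i))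

theorem Algorithm.log_roundRatio_reward (i : Fin n) (ε : ℝ) (t : ℕ) (ω : A.Outcome) :
    Real.log (A.roundRatio i ε t ω (A.reward t ω))
      = ({ω | A.Alive (t + 1) ω ∧ A.arm t ω = i} ∩ {ω | A.reward t ω = 1}).indicator
          (fun _ => Real.log (1 + 2 * ε)) ω
        + ({ω | A.Alive (t + 1) ω ∧ A.arm t ω = i} \ {ω | A.reward t ω = 1}).indicator
          (fun _ => Real.log (1 - 2 * ε)) ω := by
  classical
  by_cases h : A.Alive (t + 1) ω ∧ A.arm t ω = i <;> by_cases h1 : A.reward t ω = 1 <;>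
    simp [Algorithm.roundRatio, h, h1]

theorem Algorithm.integrable_log_roundRatio (i : Fin n) (ε : ℝ) (t : ℕ) :
    Integrable (fun ω => Real.log (A.roundRatio i ε t ω (A.reward t ω)))
      (A.prob (fairInstance n)) := by
  simp_rw [Algorithm.log_roundRatio_reward]
  have hB := Algorithm.measurableSet_alive_arm (A := A) i t
  have hR : MeasurableSet {ω | A.reward t ω = 1} :=
    A.measurable_reward t (measurableSet_singleton 1)
  exact ((integrable_const _).indicator (hB.inter hR)).add
    ((integrable_const _).indicator (hB.diff hR))

/-- Wald's identity for one round: the mean increment of the log-likelihood is proportional to the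
probability that arm `i` is pulled in this round. -/
theorem Algorithm.integral_log_roundRatio (i : Fin n) (ε : ℝ) (t : ℕ) :
    ∫ ω, Real.log (A.roundRatio i ε t ω (A.reward t ω)) ∂(A.prob (fairInstance n))
      = (Real.log (1 + 2 * ε) + Real.log (1 - 2 * ε)) / 2
        * (A.prob (fairInstance n)).real {ω | A.Alive (t + 1) ω ∧ A.arm t ω = i} := by
  simp_rw [Algorithm.log_roundRatio_reward]
  have hB := Algorithm.measurableSet_alive_arm (A := A) i t
  have hR : MeasurableSet {ω | A.reward t ω = 1} :=
    A.measurable_reward t (measurableSet_singleton 1)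
  have hsum := measureReal_inter_add_sdiff (μ := A.prob (fairInstance n))
    (s := {ω | A.Alive (t + 1) ω ∧ A.arm t ω = i}) hR
  have hhalf := Algorithm.prob_pull_and_reward_eq_one (A := A) i t
  rw [integral_add ((integrable_const _).indicator (hB.inter hR))
    ((integrable_const _).indicator (hB.diff hR)), integral_indicator_const _ (hB.inter hR),
    integral_indicator_const _ (hB.diff hR)]
  rw [hhalf] at hsum
  rw [hhalf, eq_sub_of_add_eq' hsum, smul_eq_mul, smul_eq_mul]
  ring

theorem neg_log_add_log_div_two_le {ε : ℝ} (h0 : 0 < ε) (h1 : ε ≤ 1 / 8) :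
    -((Real.log (1 + 2 * ε) + Real.log (1 - 2 * ε)) / 2) ≤ 3 * ε ^ 2 := by
  have hy : 0 < 1 - 4 * ε ^ 2 := by nlinarith
  have h := Real.one_sub_inv_le_log_of_pos hy
  have hl : Real.log (1 + 2 * ε) + Real.log (1 - 2 * ε) = Real.log (1 - 4 * ε ^ 2) := by
    rw [← Real.log_mul (by linarith) (by linarith)]; congr 1; ring
  have hi : (1 - 4 * ε ^ 2)⁻¹ ≤ 1 + 6 * ε ^ 2 := by
    have hε : ε ^ 2 ≤ 1 / 64 := by nlinarith
    rw [inv_le_iff_one_le_mul₀ hy]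
    nlinarith [mul_le_mul_of_nonneg_left hε (sq_nonneg ε)]
  rw [hl]; linarith

theorem Algorithm.log_likelihood (i : Fin n) {ε : ℝ} (h0 : 0 < ε) (h1 : ε ≤ 1 / 8) (N : ℕ)
    (ω : A.Outcome) : Real.log (A.likelihood i ε N ω)
      = ∑ s ∈ Finset.range N, Real.log (A.roundRatio i ε s ω (A.reward s ω)) :=
  Real.log_prod fun s _ => (lt_of_lt_of_le (by norm_num)
    (Algorithm.roundRatio_mem i h0 h1 s ω _).1).ne'

/-- The information inequality for arm `i`, truncated after `N` rounds: a sizeable probability of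
discarding arm `i` on the fair instance forces many pulls of this arm, since it is discarded with
probability at most `δ` when it is biased. -/
theorem Algorithm.IsPAC.log_mul_prob_discarded_le {ε δ x : ℝ} (hA : A.IsPAC ε δ) (i : Fin n)
    (h0 : 0 < ε) (h1 : ε ≤ 1 / 8) (hδ : 0 ≤ δ) (hx : 1 ≤ x) (N : ℕ) :
    Real.log x * (A.prob (fairInstance n)).real {ω | A.Discarded i N ω}
      ≤ 3 * ε ^ 2 * ∑ s ∈ Finset.range N,
          (A.prob (fairInstance n)).real {ω | A.Alive (s + 1) ω ∧ A.arm s ω = i}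
        + (x - 1) * δ := by
  classical
  set P := A.prob (fairInstance n) with hP
  set D := {ω | A.Discarded i N ω} with hD
  have hDm : MeasurableSet D := Algorithm.measurableSet_discarded i N
  set Z := A.likelihood i ε N with hZ
  have hZpos : ∀ ω, 0 < Z ω := Algorithm.likelihood_pos i h0 h1 N
  have hZm : Measurable Z := Algorithm.measurable_likelihood i ε N
  have hZint : ∫⁻ ω, ENNReal.ofReal (Z ω) ∂P = 1 := Algorithm.lintegral_likelihood i h0 h1 N
  have hZi : Integrable Z P := by
    refine ⟨hZm.aestronglyMeasurable, ?_⟩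
    rw [hasFiniteIntegral_iff_ofReal (Filter.Eventually.of_forall fun ω => (hZpos ω).le), hZint]
    exact ENNReal.one_lt_top
  have hEZ : ∫ ω, Z ω ∂P = 1 := by
    rw [integral_eq_lintegral_of_nonneg_ae (Filter.Eventually.of_forall fun ω => (hZpos ω).le)
      hZm.aestronglyMeasurable, hZint, ENNReal.toReal_one]
  have hEZD : ∫ ω, D.indicator Z ω ∂P ≤ δ := by
    rw [integral_eq_lintegral_of_nonneg_ae
      (Filter.Eventually.of_forall fun ω => Set.indicator_nonneg (fun ω _ => (hZpos ω).le) ω)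
      (hZm.indicator hDm).aestronglyMeasurable]
    have : ∫⁻ ω, ENNReal.ofReal (D.indicator Z ω) ∂P
        = A.prob (biasedInstance i h0 h1) {ω | A.Discarded i N ω} := by
      rw [← Algorithm.lintegral_likelihood_discarded i h0 h1 N]
      refine lintegral_congr fun ω => ?_
      by_cases h : A.Discarded i N ω <;> simp [hD, h, hZ]
    rw [this]
    exact ENNReal.toReal_le_of_le_ofReal hδ (hA.prob_discarded_le i h0 h1 N)
  have hlogi : Integrable (fun ω => Real.log (Z ω)) P := by
    simp only [hZ, Algorithm.log_likelihood i h0 h1]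
    exact integrable_finsetSum _ fun s _ => Algorithm.integrable_log_roundRatio i ε s
  have hlog : -∫ ω, Real.log (Z ω) ∂P ≤ 3 * ε ^ 2 * ∑ s ∈ Finset.range N,
      P.real {ω | A.Alive (s + 1) ω ∧ A.arm s ω = i} := by
    simp only [hZ, Algorithm.log_likelihood i h0 h1]
    rw [integral_finsetSum _ fun s _ => Algorithm.integrable_log_roundRatio i ε s]
    simp only [Algorithm.integral_log_roundRatio]
    rw [← Finset.mul_sum, ← neg_mul]
    exact mul_le_mul_of_nonneg_right (neg_log_add_log_div_two_le h0 h1)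
      (Finset.sum_nonneg fun s _ => measureReal_nonneg)
  have hpt : ∀ ω, 1 + D.indicator (fun _ => Real.log x) ω
      ≤ -Real.log (Z ω) + Z ω + (x - 1) * D.indicator Z ω := by
    intro ω
    by_cases h : ω ∈ D
    · have := Real.log_le_sub_one_of_pos (mul_pos (lt_of_lt_of_le one_pos hx) (hZpos ω))
      rw [Real.log_mul (by linarith) (hZpos ω).ne'] at this
      simp only [Set.indicator_of_mem h]
      linarith
    · have := Real.log_le_sub_one_of_pos (hZpos ω)
      simp only [Set.indicator_of_notMem h]
      linarith
  have hmono := integral_mono (μ := P)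
    ((integrable_const (1 : ℝ)).add ((integrable_const (Real.log x)).indicator hDm))
    ((hlogi.neg.add hZi).add ((hZi.indicator hDm).const_mul (x - 1))) hpt
  have hl : ∫ ω, (1 + D.indicator (fun _ => Real.log x) ω) ∂P = 1 + Real.log x * P.real D := by
    rw [integral_add (integrable_const _) ((integrable_const _).indicator hDm),
      integral_indicator_const _ hDm, smul_eq_mul, mul_comm]
    simp
  have hr : ∫ ω, (-Real.log (Z ω) + Z ω + (x - 1) * D.indicator Z ω) ∂P
      = -∫ ω, Real.log (Z ω) ∂P + 1 + (x - 1) * ∫ ω, D.indicator Z ω ∂P := by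
    have e1 := integral_add (μ := P) (f := fun ω => -Real.log (Z ω) + Z ω)
      (hlogi.neg.add hZi) ((hZi.indicator hDm).const_mul (x - 1))
    have e2 := integral_add (μ := P) (f := fun ω => -Real.log (Z ω)) hlogi.neg hZi
    rw [e1, e2, hEZ, integral_const_mul, integral_neg]
  have hmono' : 1 + Real.log x * P.real D
      ≤ -∫ ω, Real.log (Z ω) ∂P + 1 + (x - 1) * ∫ ω, D.indicator Z ω ∂P := hl ▸ hr ▸ hmono
  have h3 : (x - 1) * ∫ ω, D.indicator Z ω ∂P ≤ (x - 1) * δ :=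
    mul_le_mul_of_nonneg_left hEZD (by linarith)
  linarith

theorem Algorithm.exists_halt_of_not_alive {N : ℕ} {ω : A.Outcome} (h : ¬ A.Alive N ω) :
    ∃ s < N, A.Alive s ω ∧ A.halt s (ω.1, A.history ω s) = true := by
  induction N with
  | zero => exact absurd (A.alive_zero ω) h
  | succ N ih =>
    by_cases ha : A.Alive N ω
    · rw [A.alive_succ] at h
      exact ⟨N, by omega, ha, by simpa [ha] using h⟩
    · obtain ⟨s, hs, h'⟩ := ih ha
      exact ⟨s, by omega, h'⟩

/-- An algorithm that has stopped before round `N` has discarded `n - m` arms. -/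
theorem Algorithm.mul_prob_stopped_le_sum_prob_discarded (ν : Instance n) (N : ℕ) :
    ((n : ℝ) - m) * (1 - (A.prob ν).real {ω | A.Alive N ω})
      ≤ ∑ i, (A.prob ν).real {ω | A.Discarded i N ω} := by
  classical
  have hal := A.measurableSet_alive N
  rw [← probReal_compl_eq_one_sub hal]
  have h1 : ∀ i, (A.prob ν).real {ω | A.Discarded i N ω}
      = ∫ ω, {ω | A.Discarded i N ω}.indicator (fun _ => (1 : ℝ)) ω ∂(A.prob ν) := fun i => by
    rw [integral_indicator_const _ (Algorithm.measurableSet_discarded i N), smul_eq_mul, mul_one]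
  have h2 : ((n : ℝ) - m) * (A.prob ν).real {ω | A.Alive N ω}ᶜ
      = ∫ ω, {ω | A.Alive N ω}ᶜ.indicator (fun _ => ((n : ℝ) - m)) ω ∂(A.prob ν) := by
    rw [integral_indicator_const _ hal.compl, smul_eq_mul, mul_comm]
  have hint : ∀ i : Fin n, Integrable
      ({ω | A.Discarded i N ω}.indicator (fun _ => (1 : ℝ))) (A.prob ν) := fun i =>
    (integrable_const _).indicator (Algorithm.measurableSet_discarded i N)
  simp_rw [h1, h2]
  rw [← integral_finsetSum _ fun i _ => hint i]
  refine integral_mono ((integrable_const _).indicator hal.compl)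
    (integrable_finsetSum _ fun i _ => hint i) fun ω => ?_
  by_cases h : A.Alive N ω
  · rw [Set.indicator_of_notMem (by simpa using h)]
    exact Finset.sum_nonneg fun i _ => Set.indicator_nonneg (fun _ _ => zero_le_one) _
  · rw [Set.indicator_of_mem (by simpa using h)]
    obtain ⟨s, hs, ha, hh⟩ := Algorithm.exists_halt_of_not_alive h
    set R := A.retain s (ω.1, A.history ω s) with hR
    have hc : (n : ℝ) - m = ∑ i, if i ∉ R then (1 : ℝ) else 0 := by
      have : ∑ i, (if i ∉ R then (1 : ℝ) else 0) = ((Finset.univ \ R).card : ℝ) := by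
        rw [Finset.sum_ite, Finset.sum_const_zero, add_zero, Finset.sum_const, nsmul_eq_mul,
          mul_one]
        congr 2
        ext i; simp
      rw [this, Finset.card_sdiff_of_subset (Finset.subset_univ _), Nat.cast_sub
        (Finset.card_le_card (Finset.subset_univ _)), hR, A.card_retain]
      simp
    rw [hc]
    refine Finset.sum_le_sum fun i _ => ?_
    by_cases hi : i ∈ R
    · simp only [hi, not_true_eq_false, if_false]
      exact Set.indicator_nonneg (fun _ _ => zero_le_one) _
    · have : ω ∈ {ω | A.Discarded i N ω} := ⟨s, hs, ha, hh, hi⟩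
      rw [Set.indicator_of_mem this]
      simp [hi]

/-- A tail-sum bound for the expected number of samples, truncated after `N` rounds. -/
theorem Algorithm.sum_prob_alive_le (ν : Instance n) (N : ℕ) :
    ∑ s ∈ Finset.range N, A.prob ν {ω | A.Alive (s + 1) ω}
      ≤ ∫⁻ ω, ((A.samples ω : ℕ∞) : ℝ≥0∞) ∂(A.prob ν) := by
  classical
  have h : ∀ s, A.prob ν {ω | A.Alive (s + 1) ω}
      = ∫⁻ ω, {ω | A.Alive (s + 1) ω}.indicator 1 ω ∂(A.prob ν) := fun s =>
    (lintegral_indicator_one (A.measurableSet_alive (s + 1))).symm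
  simp_rw [h]
  rw [← lintegral_finsetSum _ fun s _ => measurable_one.indicator (A.measurableSet_alive (s + 1))]
  refine lintegral_mono fun ω => ?_
  dsimp only
  have hrw : ∀ s, {ω | A.Alive (s + 1) ω}.indicator (1 : A.Outcome → ℝ≥0∞) ω
      = if ((s + 1 : ℕ) : ℕ∞) ≤ A.samples ω then 1 else 0 := fun s => by
    simp only [Set.indicator_apply, Set.mem_ofPred_eq, A.alive_iff_le_samples, Pi.one_apply]
  simp_rw [hrw]
  generalize A.samples ω = T
  induction T using ENat.recTopCoe with
  | top => simp
  | coe a =>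
    simp only [Nat.cast_le]
    rw [← Finset.sum_filter, Finset.sum_const, nsmul_eq_mul, mul_one]
    have : ((Finset.range N).filter fun s => s + 1 ≤ a).card ≤ a := by
      calc _ ≤ (Finset.range a).card := Finset.card_le_card fun s hs => by
            simp only [Finset.mem_filter, Finset.mem_range] at hs ⊢; omega
        _ = a := Finset.card_range a
    exact_mod_cast this

/-- The sum over all arms of the information inequalities, in the limit of an infinite horizon. -/
theorem Algorithm.IsPAC.log_mul_le_expected_samples {ε δ x : ℝ} (hA : A.IsPAC ε δ)
    (h0 : 0 < ε) (h1 : ε ≤ 1 / 8) (hδ : 0 ≤ δ) (hx : 1 ≤ x) (hmn : m ≤ n)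
    (hT : ∫⁻ ω, ((A.samples ω : ℕ∞) : ℝ≥0∞) ∂(A.prob (fairInstance n)) ≠ ∞) :
    Real.log x * ((n : ℝ) - m)
      ≤ 3 * ε ^ 2 * (∫⁻ ω, ((A.samples ω : ℕ∞) : ℝ≥0∞) ∂(A.prob (fairInstance n))).toReal
        + n * ((x - 1) * δ) := by
  set P := A.prob (fairInstance n) with hP
  set τ := (∫⁻ ω, ((A.samples ω : ℕ∞) : ℝ≥0∞) ∂P).toReal with hτ
  have hsum : ∀ N, ∑ s ∈ Finset.range N, P.real {ω | A.Alive (s + 1) ω} ≤ τ := fun N => by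
    have := ENNReal.toReal_mono hT (A.sum_prob_alive_le (fairInstance n) N)
    rwa [ENNReal.toReal_sum fun s _ => measure_ne_top _ _] at this
  have hmk : 0 ≤ (n : ℝ) - m := by
    rw [sub_nonneg]; exact_mod_cast hmn
  have hlogx : 0 ≤ Real.log x := Real.log_nonneg hx
  have hN : ∀ N, Real.log x * (((n : ℝ) - m) * (1 - P.real {ω | A.Alive N ω}))
      ≤ 3 * ε ^ 2 * τ + n * ((x - 1) * δ) := fun N => by
    calc _ ≤ Real.log x * ∑ i, P.real {ω | A.Discarded i N ω} :=
          mul_le_mul_of_nonneg_left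
            (Algorithm.mul_prob_stopped_le_sum_prob_discarded (fairInstance n) N) hlogx
      _ = ∑ i, Real.log x * P.real {ω | A.Discarded i N ω} := Finset.mul_sum _ _ _
      _ ≤ ∑ i, (3 * ε ^ 2 * ∑ s ∈ Finset.range N,
          P.real {ω | A.Alive (s + 1) ω ∧ A.arm s ω = i} + (x - 1) * δ) :=
        Finset.sum_le_sum fun i _ => hA.log_mul_prob_discarded_le i h0 h1 hδ hx N
      _ = 3 * ε ^ 2 * ∑ s ∈ Finset.range N, ∑ i,
          P.real {ω | A.Alive (s + 1) ω ∧ A.arm s ω = i} + n * ((x - 1) * δ) := by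
        rw [Finset.sum_add_distrib, ← Finset.mul_sum, Finset.sum_comm]; simp
      _ = 3 * ε ^ 2 * ∑ s ∈ Finset.range N, P.real {ω | A.Alive (s + 1) ω}
          + n * ((x - 1) * δ) := by
        congr 2
        refine Finset.sum_congr rfl fun s _ => ?_
        have hun : {ω | A.Alive (s + 1) ω}
            = ⋃ i ∈ (Finset.univ : Finset (Fin n)), {ω | A.Alive (s + 1) ω ∧ A.arm s ω = i} := by
          ext ω; simp
        conv_rhs => rw [hun]
        rw [measureReal_biUnion_finset]
        · intro i _ j _ hij
          refine Set.disjoint_left.2 fun ω hi hj => hij ?_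
          exact hi.2.symm.trans hj.2
        · exact fun i _ => Algorithm.measurableSet_alive_arm i s
      _ ≤ _ := by
        have := mul_le_mul_of_nonneg_left (hsum N) (by positivity : (0 : ℝ) ≤ 3 * ε ^ 2)
        linarith
  -- By Markov's inequality the probability of running for `N` rounds tends to zero.
  have hmarkov : ∀ N : ℕ, P.real {ω | A.Alive (N + 1) ω} ≤ τ / ((N : ℝ) + 1) := fun N => by
    rw [le_div_iff₀ (by positivity)]
    calc _ = ∑ s ∈ Finset.range (N + 1), P.real {ω | A.Alive (N + 1) ω} := by
          simp [mul_comm]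
      _ ≤ ∑ s ∈ Finset.range (N + 1), P.real {ω | A.Alive (s + 1) ω} := by
        refine Finset.sum_le_sum fun s hs => measureReal_mono fun ω h s' hs' => h s' ?_
        rw [Finset.mem_range] at hs
        omega
      _ ≤ τ := hsum (N + 1)
  have hlim : Filter.Tendsto (fun N : ℕ => Real.log x * (((n : ℝ) - m) * (1 - τ / ((N : ℝ) + 1))))
      Filter.atTop (nhds (Real.log x * (((n : ℝ) - m) * (1 - 0)))) := by
    have hz : Filter.Tendsto (fun N : ℕ => τ / ((N : ℝ) + 1)) Filter.atTop (nhds 0) := by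
      have := (tendsto_one_div_add_atTop_nhds_zero_nat (𝕜 := ℝ)).const_mul τ
      simpa [div_eq_mul_inv] using this
    exact ((hz.const_sub 1).const_mul _).const_mul _
  rw [sub_zero, mul_one] at hlim
  refine le_of_tendsto hlim (Filter.Eventually.of_forall fun N => le_trans ?_ (hN (N + 1)))
  have := hmarkov N
  gcongr

/-- `y - 1 + exp (-y)` is at least a constant multiple of `y` on `[y₀, ∞)`, by convexity of
`exp`. -/
theorem mul_le_sub_one_add_exp_neg {y₀ y : ℝ} (h0 : 0 < y₀) (h : y₀ ≤ y) :
    (1 - (1 - Real.exp (-y₀)) / y₀) * y ≤ y - 1 + Real.exp (-y) := by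
  have hy : 0 < y := h0.trans_le h
  have hc : Real.exp ((1 - y₀ / y) • (0 : ℝ) + (y₀ / y) • (-y))
      ≤ (1 - y₀ / y) • Real.exp 0 + (y₀ / y) • Real.exp (-y) :=
    convexOn_exp.2 (Set.mem_univ 0) (Set.mem_univ (-y))
      (by rw [sub_nonneg, div_le_one hy]; exact h) (by positivity) (by ring)
  have he : (1 - y₀ / y) • (0 : ℝ) + (y₀ / y) • (-y) = -y₀ := by
    simp only [smul_eq_mul]; field_simp; ring
  rw [he] at hc
  simp only [smul_eq_mul, Real.exp_zero, mul_one] at hc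
  have h2 : (1 - Real.exp (-y)) ≤ (1 - Real.exp (-y₀)) / y₀ * y := by
    rw [div_mul_eq_mul_div, le_div_iff₀ h0]
    have : y * Real.exp (-y₀) ≤ y * (1 - y₀ / y + y₀ / y * Real.exp (-y)) :=
      mul_le_mul_of_nonneg_left hc hy.le
    have e : y * (1 - y₀ / y + y₀ / y * Real.exp (-y)) = y - y₀ + y₀ * Real.exp (-y) := by
      field_simp
    rw [e] at this
    linarith
  linarith

theorem one_sub_exp_neg_div_lt_one {y : ℝ} (h : 0 < y) : (1 - Real.exp (-y)) / y < 1 := by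
  rw [div_lt_one h]
  have := Real.add_one_lt_exp (x := -y) (by linarith)
  linarith

/-- The ratio `(n - m) / (n δ)` is bounded away from `1`. -/
theorem inv_le_ratio {n m : ℕ} {β δ : ℝ} (hβ1 : β < 1) (hmn : m < n) (hδ0 : 0 < δ)
    (hδ : δ ≤ ((n : ℝ) - m) / n * (1 - β)) : (1 - β)⁻¹ ≤ ((n : ℝ) - m) / (n * δ) := by
  have hn : (0 : ℝ) < n := by exact_mod_cast (Nat.zero_le m).trans_lt hmn
  rw [inv_le_iff_one_le_mul₀ (by linarith), div_mul_eq_mul_div, one_le_div (by positivity)]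
  calc (n : ℝ) * δ ≤ n * (((n : ℝ) - m) / n * (1 - β)) := by gcongr
    _ = _ := by field_simp

/-- The lower bound. With `y₀ = -log (1 - β)` the constant is a third of `1 - (1 - exp (-y₀)) / y₀`. -/
theorem Algorithm.IsPAC.ofReal_rate_le {β ε δ : ℝ} (hβ0 : 0 < β) (hβ1 : β < 1) (hmn : m < n)
    (h0 : 0 < ε) (h1 : ε ≤ 1 / 8) (hδ0 : 0 < δ) (hδ : δ ≤ ((n : ℝ) - m) / n * (1 - β))
    (hA : A.IsPAC ε δ) :
    ENNReal.ofReal ((1 - (1 - Real.exp (-(-Real.log (1 - β)))) / (-Real.log (1 - β))) / 3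
      * rate n m ε δ) ≤ A.sampleComplexity := by
  refine le_trans ?_ (le_iSup (fun ν : Instance n =>
    ∫⁻ ω, ((A.samples ω : ℕ∞) : ℝ≥0∞) ∂(A.prob ν)) (fairInstance n))
  by_cases hT : ∫⁻ ω, ((A.samples ω : ℕ∞) : ℝ≥0∞) ∂(A.prob (fairInstance n)) = ∞
  · simp [hT]
  rw [← ENNReal.ofReal_toReal hT]
  refine ENNReal.ofReal_le_ofReal ?_
  have hn : (0 : ℝ) < n := by exact_mod_cast (Nat.zero_le m).trans_lt hmn
  have hk : (0 : ℝ) < (n : ℝ) - m := by rw [sub_pos]; exact_mod_cast hmn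
  have hβ : 0 < 1 - β := by linarith
  set x := ((n : ℝ) - m) / (n * δ) with hx
  have hxβ : (1 - β)⁻¹ ≤ x := inv_le_ratio hβ1 hmn hδ0 hδ
  have hx1 : 1 ≤ x := ((one_le_inv₀ hβ).2 (by linarith)).trans hxβ
  have hx0 : 0 < x := by linarith
  have hy0 : 0 < -Real.log (1 - β) := neg_pos.2 (Real.log_neg hβ (by linarith))
  have hy : -Real.log (1 - β) ≤ Real.log x := by
    rw [← Real.log_inv]; exact Real.log_le_log (by positivity) hxβ
  have hconv := mul_le_sub_one_add_exp_neg hy0 hy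
  rw [Real.exp_neg (Real.log x), Real.exp_log hx0] at hconv
  have hmain := hA.log_mul_le_expected_samples h0 h1 hδ0.le hx1 hmn.le hT
  have hnδ : (n : ℝ) * ((x - 1) * δ) = ((n : ℝ) - m) * (1 - x⁻¹) := by
    have : (n : ℝ) - m = x * (n * δ) := by rw [hx]; field_simp
    rw [this]; field_simp
  rw [hnδ] at hmain
  set c := 1 - (1 - Real.exp (-(-Real.log (1 - β)))) / (-Real.log (1 - β)) with hc
  set τ := (∫⁻ ω, ((A.samples ω : ℕ∞) : ℝ≥0∞) ∂(A.prob (fairInstance n))).toReal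
  have h3 : ((n : ℝ) - m) * (c * Real.log x) ≤ 3 * ε ^ 2 * τ := by
    have := mul_le_mul_of_nonneg_left hconv hk.le
    linarith
  have : c / 3 * rate n m ε δ = ((n : ℝ) - m) * (c * Real.log x) / (3 * ε ^ 2) := by
    rw [rate, ← hx]; field_simp
  rw [this, div_le_iff₀ (by positivity)]
  linarith

end LowerBound

/-! ### Decision trees and knockout tournaments -/

section Trees

/-- A decision tree for Bernoulli rewards: a node pulls an arm and branches on the binary reward,
a leaf returns a result. -/
inductive DecisionTree (n : ℕ) (α : Type) : Type
  | leaf (a : α) : DecisionTree n α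
  | node (i : Fin n) (next : Bool → DecisionTree n α) : DecisionTree n α

namespace DecisionTree

variable {n : ℕ} {α β : Type}

/-- The expected value of `f` at the leaf that is reached if arm `i` yields `true` with
probability `q i`. -/
def expect (q : Fin n → ℝ) (f : α → ℝ) : DecisionTree n α → ℝ
  | leaf a => f a
  | node i next => (1 - q i) * (next false).expect q f + q i * (next true).expect q f

/-- Run a tree, then the tree chosen by its result. -/
def bind (g : α → DecisionTree n β) : DecisionTree n α → DecisionTree n β
  | leaf a => g a
  | node i next => node i fun b => (next b).bind g

/-- The largest number of pulls along a branch. -/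
def depth : DecisionTree n α → ℕ
  | leaf _ => 0
  | node _ next => max (next false).depth (next true).depth + 1

theorem expect_bind (q : Fin n → ℝ) (f : β → ℝ) (g : α → DecisionTree n β) (T : DecisionTree n α) :
    (T.bind g).expect q f = T.expect q fun a => (g a).expect q f := by
  induction T with
  | leaf a => rfl
  | node i next ih => simp only [bind, expect, ih]

theorem expect_mono {q : Fin n → ℝ} (hq : ∀ i, q i ∈ Set.Icc (0 : ℝ) 1) {f g : α → ℝ}
    (h : ∀ a, f a ≤ g a) (T : DecisionTree n α) : T.expect q f ≤ T.expect q g := by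
  induction T with
  | leaf a => exact h a
  | node i next ih =>
    have h0 := (hq i).1
    have h1 : 0 ≤ 1 - q i := sub_nonneg.2 (hq i).2
    exact add_le_add (mul_le_mul_of_nonneg_left (ih false) h1)
      (mul_le_mul_of_nonneg_left (ih true) h0)

theorem expect_const (q : Fin n → ℝ) (c : ℝ) (T : DecisionTree n α) : T.expect q (fun _ => c) = c := by
  induction T with
  | leaf a => rfl
  | node i next ih => simp only [expect, ih]; ring

theorem expect_add (q : Fin n → ℝ) (f g : α → ℝ) (T : DecisionTree n α) :
    T.expect q (fun a => f a + g a) = T.expect q f + T.expect q g := by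
  induction T with
  | leaf a => rfl
  | node i next ih => simp only [expect, ih]; ring

theorem expect_one_sub (q : Fin n → ℝ) (f : α → ℝ) (T : DecisionTree n α) :
    T.expect q (fun a => 1 - f a) = 1 - T.expect q f := by
  induction T with
  | leaf a => rfl
  | node i next ih => simp only [expect, ih]; ring

theorem expect_nonneg {q : Fin n → ℝ} (hq : ∀ i, q i ∈ Set.Icc (0 : ℝ) 1) {f : α → ℝ}
    (h : ∀ a, 0 ≤ f a) (T : DecisionTree n α) : 0 ≤ T.expect q f := by
  have := expect_mono hq h T
  rwa [expect_const] at this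

theorem depth_bind_le {g : α → DecisionTree n β} {N : ℕ} (hg : ∀ a, (g a).depth ≤ N) (T : DecisionTree n α) :
    (T.bind g).depth ≤ T.depth + N := by
  induction T with
  | leaf a => simpa [bind, depth] using hg a
  | node i next ih =>
    have h0 := ih false
    have h1 := ih true
    simp only [bind, depth]
    omega

end DecisionTree

open DecisionTree

/-- Pull arms `i` and `j` alternately, `k` times each, and return whether arm `i` collected at least
as much reward as arm `j`; `d` is the lead of arm `i` so far. -/
def duel {n : ℕ} (i j : Fin n) : ℕ → ℤ → DecisionTree n Bool
  | 0, d => leaf (decide (0 ≤ d))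
  | k + 1, d => node i fun b => node j fun b' => duel i j k (d + b.toNat - b'.toNat)

theorem depth_duel {n : ℕ} (i j : Fin n) (k : ℕ) (d : ℤ) : (duel i j k d).depth = 2 * k := by
  induction k generalizing d with
  | zero => rfl
  | succ k ih => simp only [duel, depth, ih]; omega

/-- Exponential Markov inequality for a duel. The sign of `l` decides which outcome is bounded. -/
theorem expect_duel_le {n : ℕ} {q : Fin n → ℝ} (hq : ∀ i, q i ∈ Set.Icc (0 : ℝ) 1) (i j : Fin n)
    (l : ℝ) {f : Bool → ℝ} (hf : ∀ d : ℤ, f (decide (0 ≤ d)) ≤ Real.exp (l * d)) (k : ℕ) (d : ℤ) :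
    (duel i j k d).expect q f ≤ Real.exp (l * d) *
      ((1 - q i + q i * Real.exp l) * (1 - q j + q j * Real.exp (-l))) ^ k := by
  induction k generalizing d with
  | zero => simpa [duel, expect] using hf d
  | succ k ih =>
    have hi0 := (hq i).1
    have hi1 : 0 ≤ 1 - q i := sub_nonneg.2 (hq i).2
    have hj0 := (hq j).1
    have hj1 : 0 ≤ 1 - q j := sub_nonneg.2 (hq j).2
    set ρ := (1 - q i + q i * Real.exp l) * (1 - q j + q j * Real.exp (-l)) with hρ
    have e00 : Real.exp (l * ((d + (false.toNat : ℤ) - (false.toNat : ℤ) : ℤ) : ℝ))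
        = Real.exp (l * d) := by simp
    have e01 : Real.exp (l * ((d + (false.toNat : ℤ) - (true.toNat : ℤ) : ℤ) : ℝ))
        = Real.exp (l * d) * Real.exp (-l) := by
      rw [← Real.exp_add]; congr 1; push_cast [Bool.toNat_true, Bool.toNat_false]; ring
    have e10 : Real.exp (l * ((d + (true.toNat : ℤ) - (false.toNat : ℤ) : ℤ) : ℝ))
        = Real.exp (l * d) * Real.exp l := by
      rw [← Real.exp_add]; congr 1; push_cast [Bool.toNat_true, Bool.toNat_false]; ring
    have e11 : Real.exp (l * ((d + (true.toNat : ℤ) - (true.toNat : ℤ) : ℤ) : ℝ))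
        = Real.exp (l * d) := by simp
    have h00 := ih (d + (false.toNat : ℤ) - (false.toNat : ℤ))
    have h01 := ih (d + (false.toNat : ℤ) - (true.toNat : ℤ))
    have h10 := ih (d + (true.toNat : ℤ) - (false.toNat : ℤ))
    have h11 := ih (d + (true.toNat : ℤ) - (true.toNat : ℤ))
    rw [e00] at h00
    rw [e01] at h01
    rw [e10] at h10
    rw [e11] at h11
    simp only [duel, expect]
    calc _ ≤ (1 - q i) * ((1 - q j) * (Real.exp (l * d) * ρ ^ k)
            + q j * (Real.exp (l * d) * Real.exp (-l) * ρ ^ k))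
          + q i * ((1 - q j) * (Real.exp (l * d) * Real.exp l * ρ ^ k)
            + q j * (Real.exp (l * d) * ρ ^ k)) := by gcongr
      _ = Real.exp (l * d) * ((1 - q i + q i * Real.exp l) * (1 - q j + q j * Real.exp (-l)))
            * ρ ^ k := by
          have : Real.exp l * Real.exp (-l) = 1 := by rw [← Real.exp_add]; simp
          linear_combination (-(q i * q j * Real.exp (l * d) * ρ ^ k)) * this
      _ = _ := by rw [← hρ]; ring

theorem one_sub_add_mul_exp_le {q l : ℝ} (hq : q ∈ Set.Icc (0 : ℝ) 1) (hl : |l| ≤ 1) :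
    1 - q + q * Real.exp l ≤ Real.exp (q * (l + l ^ 2)) := by
  have h := (abs_le.1 (Real.abs_exp_sub_one_sub_id_le hl)).2
  have h2 := Real.add_one_le_exp (q * (l + l ^ 2))
  have h3 := mul_le_mul_of_nonneg_left h hq.1
  linarith

/-- The factor that one pull of each arm contributes to the exponential moment of the score. -/
theorem duel_factor_le {q q' η l : ℝ} (hq : q ∈ Set.Icc (0 : ℝ) 1) (hq' : q' ∈ Set.Icc (0 : ℝ) 1)
    (hl : |l| ≤ 1) (h : l * (q - q') ≤ -(|l| * η)) :
    (1 - q + q * Real.exp l) * (1 - q' + q' * Real.exp (-l))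
      ≤ Real.exp (-(|l| * η) + 2 * l ^ 2) := by
  have h1 := one_sub_add_mul_exp_le hq hl
  have h2 := one_sub_add_mul_exp_le hq' (l := -l) (by rwa [abs_neg])
  have h0 : 0 ≤ 1 - q' + q' * Real.exp (-l) :=
    add_nonneg (sub_nonneg.2 hq'.2) (mul_nonneg hq'.1 (Real.exp_pos _).le)
  refine (mul_le_mul h1 h2 h0 (Real.exp_pos _).le).trans ?_
  rw [← Real.exp_add]
  refine Real.exp_le_exp.2 ?_
  have h3 : (q + q') * l ^ 2 ≤ 2 * l ^ 2 :=
    mul_le_mul_of_nonneg_right (by linarith [hq.2, hq'.2]) (sq_nonneg l)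
  nlinarith

/-- The arm that is worse by at least `η` wins a duel of length `k` with probability at most
`exp (-η ^ 2 / 8 * k)`. -/
theorem expect_duel_le_exp {n : ℕ} {q : Fin n → ℝ} (hq : ∀ i, q i ∈ Set.Icc (0 : ℝ) 1)
    {i j : Fin n} {η : ℝ} (h0 : 0 ≤ η) (h1 : η ≤ 1) (k : ℕ) :
    (η ≤ q i - q j → (duel i j k 0).expect q (fun w => if w then 0 else 1)
      ≤ Real.exp (-(η ^ 2 / 8 * k))) ∧
    (η ≤ q j - q i → (duel i j k 0).expect q (fun w => if w then 1 else 0)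
      ≤ Real.exp (-(η ^ 2 / 8 * k))) := by
  have key : ∀ (l : ℝ) (f : Bool → ℝ), |l| = η / 4 → l * (q i - q j) ≤ -(|l| * η) →
      (∀ d : ℤ, f (decide (0 ≤ d)) ≤ Real.exp (l * d)) →
      (duel i j k 0).expect q f ≤ Real.exp (-(η ^ 2 / 8 * k)) := by
    intro l f hl hle hf
    refine (expect_duel_le hq i j l hf k 0).trans ?_
    have hfac := duel_factor_le (hq i) (hq j) (by rw [hl]; linarith) hle
    have hnn : 0 ≤ (1 - q i + q i * Real.exp l) * (1 - q j + q j * Real.exp (-l)) :=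
      mul_nonneg (add_nonneg (sub_nonneg.2 (hq i).2) (mul_nonneg (hq i).1 (Real.exp_pos _).le))
        (add_nonneg (sub_nonneg.2 (hq j).2) (mul_nonneg (hq j).1 (Real.exp_pos _).le))
    simp only [Int.cast_zero, mul_zero, Real.exp_zero, one_mul]
    refine (pow_le_pow_left₀ hnn hfac k).trans (le_of_eq ?_)
    rw [← Real.exp_nat_mul, ← sq_abs l, hl]
    congr 1; ring
  have habs : |(-(η / 4))| = η / 4 := by rw [abs_neg, abs_of_nonneg (by linarith)]
  have habs' : |η / 4| = η / 4 := abs_of_nonneg (by linarith)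
  constructor
  · intro h
    refine key (-(η / 4)) _ habs (by rw [habs]; nlinarith) fun d => ?_
    by_cases hd : 0 ≤ d
    · simpa [hd] using (Real.exp_pos _).le
    · have : (d : ℝ) ≤ 0 := by exact_mod_cast (not_le.1 hd).le
      simp only [hd, decide_false, Bool.false_eq_true, if_false]
      exact Real.one_le_exp (by nlinarith)
  · intro h
    refine key (η / 4) _ habs' (by rw [habs']; nlinarith) fun d => ?_
    by_cases hd : 0 ≤ d
    · have : (0 : ℝ) ≤ d := by exact_mod_cast hd
      simp only [hd, decide_true, if_true]
      exact Real.one_le_exp (by positivity)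
    · simpa [hd] using (Real.exp_pos _).le

/-- A knockout tournament of height `K` among the slots `o, …, o + 2 ^ K - 1`, where slot `j` is
taken by arm `g j` and each of the two arms of a duel at height `l` is pulled `τ l` times. It returns
the slot of the winner. -/
def knockout {n : ℕ} (g : ℕ → Fin n) (τ : ℕ → ℕ) : ℕ → ℕ → DecisionTree n ℕ
  | 0, o => leaf o
  | K + 1, o => (knockout g τ K o).bind fun a => (knockout g τ K (o + 2 ^ K)).bind fun b =>
      (duel (g a) (g b) (τ K) 0).bind fun w => leaf (if w then a else b)

/-- The number of pulls of a knockout tournament of height `K`. -/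
def knockoutBudget (τ : ℕ → ℕ) : ℕ → ℕ
  | 0 => 0
  | K + 1 => 2 * knockoutBudget τ K + 2 * τ K

theorem depth_knockout_le {n : ℕ} (g : ℕ → Fin n) (τ : ℕ → ℕ) (K o : ℕ) :
    (knockout g τ K o).depth ≤ knockoutBudget τ K := by
  induction K generalizing o with
  | zero => simp [knockout, depth]
  | succ K ih =>
    have h1 : ∀ a b, ((duel (g a) (g b) (τ K) 0).bind
        fun w => (leaf (if w then a else b) : DecisionTree n ℕ)).depth ≤ 2 * τ K := fun a b => by
      have := depth_bind_le (N := 0) (g := fun w => (leaf (if w then a else b) : DecisionTree n ℕ))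
        (fun w => le_rfl) (duel (g a) (g b) (τ K) 0)
      rwa [depth_duel] at this
    have h2 : ∀ a, ((knockout g τ K (o + 2 ^ K)).bind fun b =>
        (duel (g a) (g b) (τ K) 0).bind fun w => (leaf (if w then a else b) : DecisionTree n ℕ)).depth
        ≤ knockoutBudget τ K + 2 * τ K := fun a =>
      (depth_bind_le (h1 a) _).trans (Nat.add_le_add_right (ih _) _)
    refine (depth_bind_le h2 _).trans ?_
    have := ih o
    simp only [knockoutBudget]
    omega

open scoped Classical in
/-- The winner of a knockout tournament is worse than a participating arm by more than the sum of
the tolerances `η l` only if a duel along the path of that arm fails. -/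
theorem expect_knockout_le {n : ℕ} {q : Fin n → ℝ} (hq : ∀ i, q i ∈ Set.Icc (0 : ℝ) 1)
    (g : ℕ → Fin n) (τ : ℕ → ℕ) {η : ℕ → ℝ} (h0 : ∀ l, 0 ≤ η l) (h1 : ∀ l, η l ≤ 1)
    (K o j : ℕ) (hj : o ≤ j) (hj' : j < o + 2 ^ K) :
    (knockout g τ K o).expect q
        (fun a => if q (g a) < q (g j) - ∑ l ∈ Finset.range K, η l then 1 else 0)
      ≤ ∑ l ∈ Finset.range K, Real.exp (-(η l ^ 2 / 8 * τ l)) := by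
  induction K generalizing o with
  | zero =>
    obtain rfl : j = o := by simp at hj'; omega
    simp [knockout, expect]
  | succ K ih =>
    set s := ∑ l ∈ Finset.range K, η l with hs
    set e := Real.exp (-(η K ^ 2 / 8 * τ K)) with he
    have he0 : 0 ≤ e := (Real.exp_pos _).le
    simp only [knockout, expect_bind, Finset.sum_range_succ, ← hs, ← he]
    simp only [expect]
    let bad : ℕ → ℝ := fun a => if q (g a) < q (g j) - s then 1 else 0
    have hduel : ∀ a b, (duel (g a) (g b) (τ K) 0).expect q (fun w =>
        if q (g (if w then a else b)) < q (g j) - (s + η K) then (1 : ℝ) else 0)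
        ≤ bad a + e ∧ (duel (g a) (g b) (τ K) 0).expect q (fun w =>
        if q (g (if w then a else b)) < q (g j) - (s + η K) then (1 : ℝ) else 0)
        ≤ bad b + e := by
      intro a b
      have hle1 : (duel (g a) (g b) (τ K) 0).expect q (fun w =>
          if q (g (if w then a else b)) < q (g j) - (s + η K) then (1 : ℝ) else 0) ≤ 1 := by
        refine (expect_mono hq (g := fun _ => (1 : ℝ)) (fun w => ?_) _).trans
          (expect_const _ _ _).le
        split_ifs <;> norm_num
      have hη := h0 K
      constructor
      · by_cases ha : q (g a) < q (g j) - s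
        · simp only [bad, ha, if_true]; linarith
        · simp only [bad, ha, if_false, zero_add]
          by_cases hb : q (g b) < q (g j) - (s + η K)
          · refine le_trans (expect_mono hq (fun w => ?_) _)
              ((expect_duel_le_exp hq (h0 K) (h1 K) (τ K)).1 (by linarith : η K ≤ q (g a) - q (g b)))
            cases w
            · simp [hb]
            · have : ¬ q (g a) < q (g j) - (s + η K) := by linarith
              simp [this]
          · have : ∀ w : Bool, ¬ q (g (if w then a else b)) < q (g j) - (s + η K) := by
              intro w; cases w
              · simpa using hb
              · simp only [if_true]; linarith
            simp only [this, if_false, expect_const]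
            exact he0
      · by_cases hb : q (g b) < q (g j) - s
        · simp only [bad, hb, if_true]; linarith
        · simp only [bad, hb, if_false, zero_add]
          by_cases ha : q (g a) < q (g j) - (s + η K)
          · refine le_trans (expect_mono hq (fun w => ?_) _)
              ((expect_duel_le_exp hq (h0 K) (h1 K) (τ K)).2 (by linarith : η K ≤ q (g b) - q (g a)))
            cases w
            · have : ¬ q (g b) < q (g j) - (s + η K) := by linarith
              simp [this]
            · simp [ha]
          · have : ∀ w : Bool, ¬ q (g (if w then a else b)) < q (g j) - (s + η K) := by
              intro w; cases w
              · simp only [Bool.false_eq_true, if_false]; linarith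
              · simpa using ha
            simp only [this, if_false, expect_const]
            exact he0
    by_cases hhalf : j < o + 2 ^ K
    · refine (expect_mono hq (g := fun a => bad a + e) (fun a => ?_) _).trans ?_
      · refine (expect_mono hq (fun b => (hduel a b).1) _).trans (expect_const _ _ _).le
      · rw [expect_add, expect_const]
        exact add_le_add_left (ih o hj hhalf) e
    · have hih := ih (o + 2 ^ K) (by omega) (by rw [pow_succ] at hj'; omega)
      refine (expect_mono hq (g := fun _ => _) (fun a => ?_) _).trans (expect_const _ _ _).le
      refine (expect_mono hq (fun b => (hduel a b).2) _).trans ?_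
      rw [expect_add, expect_const]
      exact add_le_add_left hih e

/-- With geometrically decreasing tolerances the budget of a duel at height `l` grows more slowly
than `2 ^ l`, and the total budget is proportional to the number of slots. -/
theorem knockoutBudget_le {τ : ℕ → ℕ} {W : ℝ} (h : ∀ l, (τ l : ℝ) ≤ (16 / 9) ^ l * (l + 1) * W)
    (K : ℕ) : (knockoutBudget τ K : ℝ)
      ≤ 2 ^ K * W * (81 - (8 / 9) ^ K * (9 * K + 81)) := by
  induction K with
  | zero => simp [knockoutBudget]
  | succ K ih =>
    have hK := h K
    simp only [knockoutBudget]
    push_cast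
    have e : (16 / 9 : ℝ) ^ K = 2 ^ K * (8 / 9) ^ K := by rw [← mul_pow]; norm_num
    rw [e] at hK
    rw [pow_succ, pow_succ]
    nlinarith

end Trees

/-! ### Running a decision tree on a bandit instance -/

section TreeAlgorithm

namespace DecisionTree

variable {n : ℕ} {α : Type}

/-- The subtree that is left after observing one binary reward; leaves are absorbing. -/
def step : DecisionTree n α → Bool → DecisionTree n α
  | leaf a, _ => leaf a
  | node _ next, b => next b

/-- The arm to pull at the root; the value `d` at a leaf is irrelevant. -/
def arm (d : Fin n) : DecisionTree n α → Fin n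
  | leaf _ => d
  | node i _ => i

/-- The result of a leaf. At a node, where no result is available yet, an arbitrary leaf is used. -/
def result : DecisionTree n α → α
  | leaf a => a
  | node _ next => (next true).result

theorem expect_eq_of_depth_eq_zero (q : Fin n → ℝ) (f : α → ℝ) {T : DecisionTree n α}
    (h : T.depth = 0) : T.expect q f = f T.result := by
  cases T with
  | leaf a => rfl
  | node i next => simp [depth] at h

theorem depth_step_le {T : DecisionTree n α} {N : ℕ} (h : T.depth ≤ N + 1) (b : Bool) :
    (T.step b).depth ≤ N := by
  cases T with
  | leaf a => simp [step, depth]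
  | node i next =>
    simp only [depth] at h
    cases b <;> simp only [step] <;> omega

end DecisionTree

variable {n m : ℕ}

/-- The sets of `m` arms. -/
abbrev KeepSet (n m : ℕ) : Type := {S : Finset (Fin n) // S.card = m}

/-- The seeds of a tree algorithm: a choice of one of `n` trees, and the thresholds that turn the
rewards into bits. -/
abbrev TreeSeed (n : ℕ) : Type := Fin n × (ℕ → ℝ)

/-- The uniform distribution on `[0, 1]`. -/
noncomputable def uniformLaw : Measure ℝ := volume.restrict (Set.Icc 0 1)

instance : IsProbabilityMeasure uniformLaw := ⟨by simp [uniformLaw]⟩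

/-- The uniform distribution on the arms. -/
noncomputable def uniformArm (n : ℕ) : Measure (Fin n) := (n : ℝ≥0∞)⁻¹ • Measure.count

instance [NeZero n] : IsProbabilityMeasure (uniformArm n) := ⟨by
  simp only [uniformArm, Measure.smul_apply, Measure.count_univ, smul_eq_mul]
  simp only [ENat.card_eq_coe_fintype_card, Fintype.card_fin]
  exact ENNReal.inv_mul_cancel (by simp [NeZero.ne n]) (by simp)⟩

/-- The law of the seed: the tree is uniformly distributed, the thresholds are independent and
uniform on `[0, 1]`. -/
noncomputable def treeSeedLaw (n : ℕ) : Measure (TreeSeed n) :=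
  (uniformArm n).prod (Measure.infinitePi fun _ : ℕ => uniformLaw)

/-- The subtree that is left after `t` rounds. The reward of each round becomes the bit that tells
whether it exceeds the threshold of this round; if the reward has mean `μ`, this bit is Bernoulli
with mean `μ`. -/
noncomputable def treeState (T : Fin n → DecisionTree n (KeepSet n m)) :
    (t : ℕ) → TreeSeed n × History n t → DecisionTree n (KeepSet n m)
  | 0, p => T p.1.1
  | t + 1, p => (treeState T t (p.1, Fin.init p.2)).step
      (decide (p.1.2 t < (p.2 (Fin.last t)).2))

theorem measurableSet_treeState (T : Fin n → DecisionTree n (KeepSet n m)) (t : ℕ)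
    (S : Set (DecisionTree n (KeepSet n m))) : MeasurableSet {p | treeState T t p ∈ S} := by
  induction t generalizing S with
  | zero => exact (measurable_fst.comp measurable_fst) (Set.toFinite {r | T r ∈ S}).measurableSet
  | succ t ih =>
    have hi : Measurable fun p : TreeSeed n × History n (t + 1) =>
        ((p.1, Fin.init p.2) : TreeSeed n × History n t) :=
      measurable_fst.prodMk (measurable_pi_lambda _ fun j =>
        (measurable_pi_apply j.castSucc).comp measurable_snd)
    have hb : MeasurableSet {p : TreeSeed n × History n (t + 1) |
        p.1.2 t < (p.2 (Fin.last t)).2} :=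
      measurableSet_lt (by fun_prop) (by fun_prop)
    have : {p | treeState T (t + 1) p ∈ S}
        = ({p | p.1.2 t < (p.2 (Fin.last t)).2} ∩
            (fun p => ((p.1, Fin.init p.2) : TreeSeed n × History n t)) ⁻¹'
              {p | treeState T t p ∈ {T' | T'.step true ∈ S}})
          ∪ ({p | p.1.2 t < (p.2 (Fin.last t)).2}ᶜ ∩
            (fun p => ((p.1, Fin.init p.2) : TreeSeed n × History n t)) ⁻¹'
              {p | treeState T t p ∈ {T' | T'.step false ∈ S}}) := by
      ext p
      by_cases h : p.1.2 t < (p.2 (Fin.last t)).2 <;> simp [treeState, h]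
    rw [this]
    exact (hb.inter (hi (ih _))).union (hb.compl.inter (hi (ih _)))

theorem measurable_comp_treeState {X : Type*} [MeasurableSpace X]
    (T : Fin n → DecisionTree n (KeepSet n m)) (t : ℕ) (f : DecisionTree n (KeepSet n m) → X) :
    Measurable fun p => f (treeState T t p) :=
  fun S _ => measurableSet_treeState T t (f ⁻¹' S)

theorem measurable_comp_treeState_arm {X : Type*} [MeasurableSpace X]
    (T : Fin n → DecisionTree n (KeepSet n m)) (t : ℕ)
    (f : Fin n → DecisionTree n (KeepSet n m) → X) :
    Measurable fun p => f p.1.1 (treeState T t p) := by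
  intro S _
  have : (fun p : TreeSeed n × History n t => f p.1.1 (treeState T t p)) ⁻¹' S
      = ⋃ r : Fin n, {p | p.1.1 = r} ∩ {p | treeState T t p ∈ f r ⁻¹' S} := by
    ext p; simp
  rw [this]
  exact MeasurableSet.iUnion fun r => MeasurableSet.inter
    ((measurable_fst.comp measurable_fst) (measurableSet_singleton r))
    (measurableSet_treeState T t _)

/-- The algorithm that follows a uniformly chosen decision tree for exactly `N` rounds, and keeps
the set at the leaf that it reaches. -/
noncomputable abbrev treeAlgorithm [NeZero n] (T : Fin n → DecisionTree n (KeepSet n m)) (N : ℕ) :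
    Algorithm n m where
  Seed := TreeSeed n
  measurableSpaceSeed := inferInstance
  seedLaw := treeSeedLaw n
  isProb := by unfold treeSeedLaw; infer_instance
  pull t p := (treeState T t p).arm p.1.1
  measurable_pull t := measurable_comp_treeState_arm T t fun r T' => T'.arm r
  halt t _ := decide (t = N)
  measurable_halt t := measurable_const
  retain t p := (treeState T t p).result.1
  measurable_retain t S := measurableSet_treeState T t {T' | T'.result.1 = S}
  card_retain t p := (treeState T t p).result.2

theorem Instance.mean_mem (ν : Instance n) (i : Fin n) : ν.mean i ∈ Set.Icc (0 : ℝ) 1 := by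
  have hint : Integrable (fun x : ℝ => x) (ν.law i) :=
    Integrable.of_mem_Icc 0 1 aemeasurable_id (ν.supp i)
  constructor
  · exact integral_nonneg_of_ae ((ν.supp i).mono fun x hx => hx.1)
  · have := integral_mono_ae hint (integrable_const (1 : ℝ)) ((ν.supp i).mono fun x hx => hx.2)
    simpa [Instance.mean] using this

/-- A uniform threshold turns a reward with values in `[0, 1]` into a Bernoulli bit with the same
mean. -/
theorem lintegral_threshold (ν : Instance n) (i : Fin n) (f : Bool → ℝ≥0∞) :
    ∫⁻ v, ∫⁻ y, f (decide (v < y)) ∂(ν.law i) ∂uniformLaw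
      = ENNReal.ofReal (1 - ν.mean i) * f false + ENNReal.ofReal (ν.mean i) * f true := by
  have hm : Measurable (Function.uncurry fun v y : ℝ => f (decide (v < y))) := by
    have : (Function.uncurry fun v y : ℝ => f (decide (v < y)))
        = fun p : ℝ × ℝ => if p.1 < p.2 then f true else f false := by
      funext p; by_cases h : p.1 < p.2 <;> simp [Function.uncurry, h]
    rw [this]
    exact Measurable.ite (measurableSet_lt measurable_fst measurable_snd) measurable_const
      measurable_const
  rw [lintegral_lintegral_swap hm.aemeasurable]
  have hin : ∀ᵐ y ∂(ν.law i), ∫⁻ v, f (decide (v < y)) ∂uniformLaw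
      = ENNReal.ofReal (1 - y) * f false + ENNReal.ofReal y * f true := by
    filter_upwards [ν.supp i] with y hy
    have hs : ∀ v, f (decide (v < y))
        = (Set.Iio y).indicator (fun _ => f true) v + (Set.Ici y).indicator (fun _ => f false) v := by
      intro v
      by_cases h : v < y
      · simp [h]
      · simp [h, not_lt.1 h]
    simp_rw [hs]
    rw [lintegral_add_left (measurable_const.indicator measurableSet_Iio),
      lintegral_indicator_const measurableSet_Iio, lintegral_indicator_const measurableSet_Ici]
    have e1 : uniformLaw (Set.Iio y) = ENNReal.ofReal y := by
      rw [uniformLaw, Measure.restrict_apply measurableSet_Iio]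
      have : Set.Iio y ∩ Set.Icc 0 1 = Set.Ico 0 y := by
        ext v
        simp only [Set.mem_inter_iff, Set.mem_Iio, Set.mem_Icc, Set.mem_Ico]
        exact ⟨fun h => ⟨h.2.1, h.1⟩, fun h => ⟨h.2, h.1, (h.2.le).trans hy.2⟩⟩
      rw [this, Real.volume_Ico, sub_zero]
    have e2 : uniformLaw (Set.Ici y) = ENNReal.ofReal (1 - y) := by
      rw [uniformLaw, Measure.restrict_apply measurableSet_Ici]
      have : Set.Ici y ∩ Set.Icc 0 1 = Set.Icc y 1 := by
        ext v
        simp only [Set.mem_inter_iff, Set.mem_Ici, Set.mem_Icc]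
        exact ⟨fun h => ⟨h.1, h.2.2⟩, fun h => ⟨h.1, hy.1.trans h.1, h.2⟩⟩
      rw [this, Real.volume_Icc]
    rw [e1, e2]
    ring
  have hint : Integrable (fun x : ℝ => x) (ν.law i) :=
    Integrable.of_mem_Icc 0 1 aemeasurable_id (ν.supp i)
  rw [lintegral_congr_ae hin, lintegral_add_left (by fun_prop), lintegral_mul_const _ (by fun_prop),
    lintegral_mul_const _ (by fun_prop),
    ← ofReal_integral_eq_lintegral_ofReal hint ((ν.supp i).mono fun x hx => hx.1),
    ← ofReal_integral_eq_lintegral_ofReal (f := fun x : ℝ => 1 - x)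
      ((integrable_const (1 : ℝ)).sub hint)
      ((ν.supp i).mono fun x hx => sub_nonneg.2 hx.2), integral_sub (integrable_const 1) hint]
  simp [Instance.mean]

variable [NeZero n] (T : Fin n → DecisionTree n (KeepSet n m)) (N : ℕ)

theorem samples_treeAlgorithm (ω : (treeAlgorithm T N).Outcome) :
    (treeAlgorithm T N).samples ω = N := by
  rw [Algorithm.samples_eq_iff]
  exact ⟨fun s hs => by simp [hs.ne], by simp⟩

/-- The subtree that is left after `t` rounds of the tree algorithm. -/
noncomputable def currentTree (t : ℕ) (ω : TreeSeed n × (ℕ → Fin n → ℝ)) :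
    DecisionTree n (KeepSet n m) :=
  treeState T t (ω.1, (treeAlgorithm T N).history ω t)

theorem currentTree_succ (t : ℕ) (ω : TreeSeed n × (ℕ → Fin n → ℝ)) :
    currentTree T N (t + 1) ω
      = (currentTree T N t ω).step (decide (ω.1.2 t < (treeAlgorithm T N).reward t ω)) := by
  unfold currentTree
  rw [Algorithm.history_succ]
  simp [treeState]

theorem depth_currentTree_le {M : ℕ} (h : ∀ r, (T r).depth ≤ M) (t : ℕ) (ht : t ≤ M)
    (ω : TreeSeed n × (ℕ → Fin n → ℝ)) : (currentTree T N t ω).depth ≤ M - t := by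
  induction t with
  | zero => exact h _
  | succ t ih =>
    rw [currentTree_succ]
    refine DecisionTree.depth_step_le ?_ _
    have := ih (by omega)
    omega

/-- The history up to round `t` does not depend on the later thresholds. -/
theorem history_treeAlgorithm_update (r : Fin n) (u : ℕ → ℝ) (x : ℕ → Fin n → ℝ) (v : ℝ)
    {s t : ℕ} (h : s ≤ t) :
    (treeAlgorithm T N).history ((r, Function.update u t v), x) s
        = (treeAlgorithm T N).history ((r, u), x) s ∧
      currentTree T N s ((r, Function.update u t v), x) = currentTree T N s ((r, u), x) := by
  induction s with
  | zero => exact ⟨rfl, rfl⟩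
  | succ s ih =>
    obtain ⟨h1, h2⟩ := ih (Nat.le_of_succ_le h)
    have harm : (treeAlgorithm T N).arm s ((r, Function.update u t v), x)
        = (treeAlgorithm T N).arm s ((r, u), x) :=
      congrArg (fun T' : DecisionTree n (KeepSet n m) => T'.arm r) h2
    have hrew : (treeAlgorithm T N).reward s ((r, Function.update u t v), x)
        = (treeAlgorithm T N).reward s ((r, u), x) := by
      simp only [Algorithm.reward, harm]
    constructor
    · rw [Algorithm.history_succ, Algorithm.history_succ, h1, harm, hrew]
    · rw [currentTree_succ, currentTree_succ, h2, hrew]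
      simp only [Function.update_of_ne (show s ≠ t by omega)]

theorem lintegral_resample_threshold (ν : Instance n) (t : ℕ)
    {G : TreeSeed n × (ℕ → Fin n → ℝ) → ℝ≥0∞} (hG : Measurable G) :
    ∫⁻ ω, G ω ∂((treeSeedLaw n).prod ν.rewardLaw)
      = ∫⁻ ω, ∫⁻ v, G ((ω.1.1, Function.update ω.1.2 t v), ω.2) ∂uniformLaw
          ∂((treeSeedLaw n).prod ν.rewardLaw) := by
  have : IsProbabilityMeasure (treeSeedLaw n) := by unfold treeSeedLaw; infer_instance
  have hup : Measurable fun p : (TreeSeed n × (ℕ → Fin n → ℝ)) × ℝ =>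
      ((p.1.1.1, Function.update p.1.1.2 t p.2), p.1.2) := by
    have := (measurePreserving_update_infinitePi (fun _ : ℕ => uniformLaw) t).measurable
    exact ((measurable_fst.comp (measurable_fst.comp measurable_fst)).prodMk
      (this.comp ((measurable_snd.comp (measurable_fst.comp measurable_fst)).prodMk
        measurable_snd))).prodMk (measurable_snd.comp measurable_fst)
  have hG2 : Measurable fun ω : TreeSeed n × (ℕ → Fin n → ℝ) =>
      ∫⁻ v, G ((ω.1.1, Function.update ω.1.2 t v), ω.2) ∂uniformLaw :=
    Measurable.lintegral_prod_right (f := fun (ω : TreeSeed n × (ℕ → Fin n → ℝ)) v =>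
      G ((ω.1.1, Function.update ω.1.2 t v), ω.2)) (hG.comp hup)
  rw [lintegral_prod_symm _ hG.aemeasurable, lintegral_prod_symm _ hG2.aemeasurable]
  refine lintegral_congr fun x => ?_
  have h1 : Measurable fun s : TreeSeed n => G (s, x) := hG.comp measurable_prodMk_right
  have h2 : Measurable fun s : TreeSeed n =>
      ∫⁻ v, G ((s.1, Function.update s.2 t v), x) ∂uniformLaw := hG2.comp measurable_prodMk_right
  unfold treeSeedLaw
  rw [lintegral_prod _ h1.aemeasurable, lintegral_prod _ h2.aemeasurable]
  exact lintegral_congr fun r => lintegral_update_infinitePi (fun _ : ℕ => uniformLaw) t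
    (h1.comp measurable_prodMk_left)

/-- The expected value of the remaining tree is preserved by each round. -/
theorem lintegral_expect_currentTree_succ (ν : Instance n) {f : KeepSet n m → ℝ}
    (hf : ∀ S, 0 ≤ f S) (t : ℕ) :
    ∫⁻ ω, ENNReal.ofReal ((currentTree T N (t + 1) ω).expect ν.mean f)
        ∂((treeSeedLaw n).prod ν.rewardLaw)
      = ∫⁻ ω, ENNReal.ofReal ((currentTree T N t ω).expect ν.mean f)
        ∂((treeSeedLaw n).prod ν.rewardLaw) := by
  have : IsProbabilityMeasure (treeSeedLaw n) := by unfold treeSeedLaw; infer_instance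
  set A := treeAlgorithm T N with hA
  let F : TreeSeed n × (ℕ → Fin n → ℝ) → ℝ → ℝ≥0∞ := fun ω y =>
    ENNReal.ofReal (((currentTree T N t ω).step (decide (ω.1.2 t < y))).expect ν.mean f)
  have hstate : Measurable fun ω : TreeSeed n × (ℕ → Fin n → ℝ) => (ω.1, A.history ω t) :=
    measurable_fst.prodMk (A.measurable_history t)
  have hF : Measurable (Function.uncurry F) := by
    have hb : ∀ b : Bool, Measurable fun p : (TreeSeed n × (ℕ → Fin n → ℝ)) × ℝ =>
        ENNReal.ofReal (((currentTree T N t p.1).step b).expect ν.mean f) := fun b =>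
      (measurable_comp_treeState T t fun T' =>
        ENNReal.ofReal ((T'.step b).expect ν.mean f)).comp (hstate.comp measurable_fst)
    have : Function.uncurry F = fun p : (TreeSeed n × (ℕ → Fin n → ℝ)) × ℝ =>
        if p.1.1.2 t < p.2 then
          ENNReal.ofReal (((currentTree T N t p.1).step true).expect ν.mean f)
        else ENNReal.ofReal (((currentTree T N t p.1).step false).expect ν.mean f) := by
      funext p
      by_cases h : p.1.1.2 t < p.2 <;> simp [Function.uncurry, F, h]
    rw [this]
    exact Measurable.ite (measurableSet_lt (by fun_prop) measurable_snd) (hb true) (hb false)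
  have hFa : ∀ z x r, F (z, Function.update x t r) = F (z, x) := fun z x r => by
    have hcur : currentTree T N t (z, Function.update x t r) = currentTree T N t (z, x) :=
      congrArg (fun h => treeState T t (z, h)) (A.history_update z x r le_rfl)
    simp only [F, hcur]
  have harm : Measurable (A.arm t) := A.measurable_arm t
  have h1 : ∫⁻ ω, ENNReal.ofReal ((currentTree T N (t + 1) ω).expect ν.mean f)
        ∂((treeSeedLaw n).prod ν.rewardLaw)
      = ∫⁻ ω, ∫⁻ y, F ω y ∂(ν.law (A.arm t ω)) ∂((treeSeedLaw n).prod ν.rewardLaw) := by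
    rw [← lintegral_observed_reward (treeSeedLaw n) ν t harm
      (fun z x r => A.arm_update z x r le_rfl) hF hFa]
    refine lintegral_congr fun ω => ?_
    rw [currentTree_succ]
    rfl
  have hG : Measurable fun ω : TreeSeed n × (ℕ → Fin n → ℝ) =>
      ∫⁻ y, F ω y ∂(ν.law (A.arm t ω)) := measurable_lintegral_law ν harm hF
  rw [h1, lintegral_resample_threshold ν t hG]
  refine lintegral_congr fun ω => ?_
  obtain ⟨⟨r, u⟩, x⟩ := ω
  dsimp only
  have hcur : ∀ v, currentTree T N t ((r, Function.update u t v), x)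
      = currentTree T N t ((r, u), x) := fun v =>
    (history_treeAlgorithm_update T N r u x v le_rfl).2
  have harm' : ∀ v, A.arm t ((r, Function.update u t v), x)
      = (currentTree T N t ((r, u), x)).arm r := fun v =>
    congrArg (fun T' : DecisionTree n (KeepSet n m) => T'.arm r) (hcur v)
  simp only [F, hcur, harm', Function.update_self]
  generalize currentTree T N t ((r, u), x) = T'
  cases T' with
  | leaf a => simp [DecisionTree.step, DecisionTree.expect]
  | node i next =>
    have hi := ν.mean_mem i
    have hnn : ∀ b, 0 ≤ (next b).expect ν.mean f := fun b =>
      DecisionTree.expect_nonneg ν.mean_mem hf _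
    simp only [DecisionTree.step, DecisionTree.arm, DecisionTree.expect]
    rw [lintegral_threshold ν i fun b => ENNReal.ofReal ((next b).expect ν.mean f),
      ENNReal.ofReal_add (mul_nonneg (sub_nonneg.2 hi.2) (hnn _)) (mul_nonneg hi.1 (hnn _)),
      ENNReal.ofReal_mul (sub_nonneg.2 hi.2), ENNReal.ofReal_mul hi.1]

/-- If all trees have depth at most `N`, the algorithm keeps a set with the property `good` with
the average of the probabilities with which the trees return such a set. -/
theorem prob_result_treeAlgorithm (ν : Instance n) (good : Set (KeepSet n m))
    (h : ∀ r, (T r).depth ≤ N) :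
    (treeAlgorithm T N).prob ν {ω | (currentTree T N N ω).result ∈ good}
      = (n : ℝ≥0∞)⁻¹ * ∑ r, ENNReal.ofReal ((T r).expect ν.mean (good.indicator 1)) := by
  have hf : ∀ S, 0 ≤ good.indicator (1 : KeepSet n m → ℝ) S :=
    fun S => Set.indicator_nonneg (fun _ _ => zero_le_one) S
  have hconst : ∀ t, ∫⁻ ω, ENNReal.ofReal ((currentTree T N t ω).expect ν.mean (good.indicator 1))
        ∂((treeSeedLaw n).prod ν.rewardLaw)
      = ∫⁻ ω, ENNReal.ofReal ((currentTree T N 0 ω).expect ν.mean (good.indicator 1))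
        ∂((treeSeedLaw n).prod ν.rewardLaw) := by
    intro t
    induction t with
    | zero => rfl
    | succ t ih => rw [lintegral_expect_currentTree_succ T N ν hf, ih]
  have hmeas : MeasurableSet {ω : TreeSeed n × (ℕ → Fin n → ℝ) |
      (currentTree T N N ω).result ∈ good} :=
    (measurable_fst.prodMk ((treeAlgorithm T N).measurable_history N))
      (measurableSet_treeState T N {T' | T'.result ∈ good})
  have hN : (treeAlgorithm T N).prob ν {ω | (currentTree T N N ω).result ∈ good}
      = ∫⁻ ω, ENNReal.ofReal ((currentTree T N N ω).expect ν.mean (good.indicator 1))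
        ∂((treeSeedLaw n).prod ν.rewardLaw) := by
    rw [← lintegral_indicator_one hmeas]
    refine lintegral_congr fun ω => ?_
    have hd : (currentTree T N N ω).depth = 0 := by
      have := depth_currentTree_le T N h N le_rfl ω
      omega
    rw [DecisionTree.expect_eq_of_depth_eq_zero _ _ hd]
    by_cases hg : (currentTree T N N ω).result ∈ good <;> simp [hg]
  rw [hN, hconst N]
  have hmap : Measure.map (fun ω : TreeSeed n × (ℕ → Fin n → ℝ) => ω.1.1)
      ((treeSeedLaw n).prod ν.rewardLaw) = uniformArm n := by
    have : IsProbabilityMeasure (treeSeedLaw n) := by unfold treeSeedLaw; infer_instance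
    have e : (fun ω : TreeSeed n × (ℕ → Fin n → ℝ) => ω.1.1) = Prod.fst ∘ Prod.fst := rfl
    rw [e, ← Measure.map_map measurable_fst measurable_fst]
    simp [treeSeedLaw]
  have : ∫⁻ r, ENNReal.ofReal ((T r).expect ν.mean (good.indicator 1)) ∂(uniformArm n)
      = ∫⁻ ω, ENNReal.ofReal ((currentTree T N 0 ω).expect ν.mean (good.indicator 1))
        ∂((treeSeedLaw n).prod ν.rewardLaw) := by
    rw [← hmap, lintegral_map (measurable_of_finite _) (by fun_prop)]
    rfl
  rw [← this, uniformArm, lintegral_smul_measure, lintegral_count, tsum_fintype, smul_eq_mul]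

end TreeAlgorithm

/-! ### The upper bound -/

section UpperBound

variable {n m : ℕ} [NeZero n]

/-- The arm in slot `j` of the tournament for the seed `r`. The slots `0, …, k` are taken by the
cyclic interval of arms `r, r + 1, …, r + k`, all later slots by the arm `r + k`. -/
def slotArm (k : ℕ) (r : Fin n) (j : ℕ) : Fin n := r + Fin.ofNat n (min j k)

/-- The `k + 1` arms that take part in the tournament for the seed `r`. -/
def contenders (k : ℕ) (r : Fin n) : Finset (Fin n) := (Finset.range (k + 1)).image (slotArm k r)

theorem slotArm_mem_contenders (k : ℕ) (r : Fin n) (j : ℕ) : slotArm k r j ∈ contenders k r :=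
  Finset.mem_image.2 ⟨min j k, Finset.mem_range.2 (by omega), by simp [slotArm]⟩

theorem card_contenders {k : ℕ} (hk : k < n) (r : Fin n) : (contenders k r).card = k + 1 := by
  unfold contenders
  rw [Finset.card_image_of_injOn, Finset.card_range]
  intro a ha b hb hab
  simp only [Finset.coe_range, Set.mem_Iio] at ha hb
  have h := add_left_cancel hab
  rw [min_eq_left (by omega), min_eq_left (by omega), Fin.ext_iff] at h
  simpa [Nat.mod_eq_of_lt (show a < n by omega), Nat.mod_eq_of_lt (show b < n by omega)] using h

/-- Each arm takes part in the tournament for at most `k + 1` of the `n` seeds. -/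
theorem card_filter_mem_contenders_le (k : ℕ) (i : Fin n) :
    (Finset.univ.filter fun r : Fin n => i ∈ contenders k r).card ≤ k + 1 := by
  calc _ ≤ ((Finset.range (k + 1)).image fun j => i - Fin.ofNat n (min j k)).card := by
        refine Finset.card_le_card fun r hr => ?_
        obtain ⟨j, hj, h⟩ := Finset.mem_image.1 (Finset.mem_filter.1 hr).2
        exact Finset.mem_image.2 ⟨j, hj, sub_eq_of_eq_add h.symm⟩
    _ ≤ (Finset.range (k + 1)).card := Finset.card_image_le
    _ = k + 1 := Finset.card_range _

/-- The arms outside the tournament together with the arm in slot `j`. -/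
def keepSet (h0 : 1 ≤ m) (h : m < n) (r : Fin n) (j : ℕ) : KeepSet n m :=
  ⟨insert (slotArm (n - m) r j) (contenders (n - m) r)ᶜ, by
    rw [Finset.card_insert_of_notMem (by simpa using slotArm_mem_contenders (n - m) r j),
      Finset.card_compl, card_contenders (by omega), Fintype.card_fin]
    omega⟩

/-- The tree that plays the tournament for the seed `r` and keeps its winner, together with all
arms that do not take part. -/
def retentionTree (h0 : 1 ≤ m) (h : m < n) (τ : ℕ → ℕ) (K : ℕ) (r : Fin n) :
    DecisionTree n (KeepSet n m) :=
  (knockout (slotArm (n - m) r) τ K 0).bind fun j => .leaf (keepSet h0 h r j)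

theorem depth_retentionTree_le (h0 : 1 ≤ m) (h : m < n) (τ : ℕ → ℕ) (K : ℕ) (r : Fin n) :
    (retentionTree h0 h τ K r).depth ≤ knockoutBudget τ K :=
  (DecisionTree.depth_bind_le (N := 0) (fun _ => le_rfl) _).trans (depth_knockout_le _ _ _ _)

open scoped Classical in
/-- The tournament can lose the best arm only for the seeds for which this arm takes part. -/
theorem le_expect_retentionTree (h0 : 1 ≤ m) (h : m < n) (τ : ℕ → ℕ) (K : ℕ)
    (hK : n - m < 2 ^ K) {η : ℕ → ℝ} (hη0 : ∀ l, 0 ≤ η l) (hη1 : ∀ l, η l ≤ 1) {ε : ℝ}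
    (hηε : ∑ l ∈ Finset.range K, η l < ε) (ν : Instance n) {i : Fin n}
    (hi : ∀ j, ν.mean j ≤ ν.mean i) (r : Fin n) :
    1 - (if i ∈ contenders (n - m) r then
        ∑ l ∈ Finset.range K, Real.exp (-(η l ^ 2 / 8 * τ l)) else 0)
      ≤ (retentionTree h0 h τ K r).expect ν.mean
          ({S : KeepSet n m | ∃ i ∈ S.1, ν.IsEpsOptimal ε i}.indicator 1) := by
  set good := {S : KeepSet n m | ∃ i ∈ S.1, ν.IsEpsOptimal ε i} with hgood
  rw [retentionTree, DecisionTree.expect_bind]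
  simp only [DecisionTree.expect]
  have hsum : 0 ≤ ∑ l ∈ Finset.range K, η l := Finset.sum_nonneg fun l _ => hη0 l
  by_cases hc : i ∈ contenders (n - m) r
  · rw [if_pos hc]
    obtain ⟨j, hj, rfl⟩ := Finset.mem_image.1 hc
    rw [Finset.mem_range] at hj
    have hfail := expect_knockout_le ν.mean_mem (slotArm (n - m) r) τ hη0 hη1 K 0 j
      (Nat.zero_le j) (by omega)
    refine le_trans (sub_le_sub_left hfail 1) ?_
    rw [← DecisionTree.expect_one_sub]
    refine DecisionTree.expect_mono ν.mean_mem (fun a => ?_) _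
    split_ifs with ha
    · rw [sub_self]
      exact Set.indicator_nonneg (fun _ _ => zero_le_one) _
    · have hmem : keepSet h0 h r a ∈ good := by
        refine ⟨slotArm (n - m) r a, Finset.mem_insert_self _ _, fun j' => ?_⟩
        have := hi j'
        linarith
      simp [hmem]
  · rw [if_neg hc, sub_zero]
    have hmem : ∀ a, keepSet h0 h r a ∈ good := fun a =>
      ⟨i, Finset.mem_insert_of_mem (by simpa using hc), fun j' => by
        have := hi j'
        linarith⟩
    simp [hmem, DecisionTree.expect_const]

/-- Averaged over the seeds, the tournament fails with probability at most `(k + 1) / n` times the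
sum of the failure probabilities of the duels on one path, where `k = n - m`. -/
theorem isPAC_treeAlgorithm_retentionTree (h0 : 1 ≤ m) (h : m < n) (τ : ℕ → ℕ) (K : ℕ)
    (hK : n - m < 2 ^ K) {η : ℕ → ℝ} (hη0 : ∀ l, 0 ≤ η l) (hη1 : ∀ l, η l ≤ 1) {ε δ : ℝ}
    (hηε : ∑ l ∈ Finset.range K, η l < ε)
    (hδ : ((n - m : ℕ) + 1) * ∑ l ∈ Finset.range K, Real.exp (-(η l ^ 2 / 8 * τ l)) ≤ n * δ) :
    (treeAlgorithm (retentionTree h0 h τ K) (knockoutBudget τ K)).IsPAC ε δ := by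
  classical
  intro ν
  set N := knockoutBudget τ K
  set T := retentionTree h0 h τ K with hT
  set good := {S : KeepSet n m | ∃ i ∈ S.1, ν.IsEpsOptimal ε i} with hgood
  set e := ∑ l ∈ Finset.range K, Real.exp (-(η l ^ 2 / 8 * τ l)) with he
  have he0 : 0 ≤ e := Finset.sum_nonneg fun l _ => (Real.exp_pos _).le
  obtain ⟨i, hi⟩ := Finite.exists_max ν.mean
  have hsub : {ω | (currentTree T N N ω).result ∈ good}
      ⊆ {ω | (treeAlgorithm T N).Succeeds ν ε ω} := fun ω hω =>
    ⟨N, samples_treeAlgorithm T N ω, hω⟩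
  refine le_trans ?_ (measure_mono hsub)
  rw [prob_result_treeAlgorithm T N ν good fun r => depth_retentionTree_le h0 h τ K r]
  have hnn : ∀ r, 0 ≤ (T r).expect ν.mean (good.indicator 1) := fun r =>
    DecisionTree.expect_nonneg ν.mean_mem
      (fun S => Set.indicator_nonneg (fun _ _ => zero_le_one) S) _
  have hn : (0 : ℝ) < n := by exact_mod_cast Nat.pos_of_ne_zero (NeZero.ne n)
  have hsum : (n : ℝ) - n * δ ≤ ∑ r, (T r).expect ν.mean (good.indicator 1) := by
    calc (n : ℝ) - n * δ ≤ n - ((n - m : ℕ) + 1) * e := by linarith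
      _ ≤ n - ((Finset.univ.filter fun r : Fin n => i ∈ contenders (n - m) r).card : ℝ) * e := by
        have : ((Finset.univ.filter fun r : Fin n => i ∈ contenders (n - m) r).card : ℝ)
            ≤ (n - m : ℕ) + 1 := by exact_mod_cast card_filter_mem_contenders_le (n - m) i
        have := mul_le_mul_of_nonneg_right this he0
        linarith
      _ = ∑ r : Fin n, (1 - (if i ∈ contenders (n - m) r then e else 0)) := by
        rw [Finset.sum_sub_distrib, ← Finset.sum_filter, Finset.sum_const, Finset.sum_const]
        simp
      _ ≤ _ := Finset.sum_le_sum fun r _ =>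
        le_expect_retentionTree h0 h τ K hK hη0 hη1 hηε ν hi r
  rw [← ENNReal.ofReal_sum_of_nonneg fun r _ => hnn r, ← ENNReal.ofReal_natCast,
    ← ENNReal.ofReal_inv_of_pos hn, ← ENNReal.ofReal_mul (by positivity)]
  refine ENNReal.ofReal_le_ofReal ?_
  rw [← div_eq_inv_mul, le_div_iff₀ hn]
  linarith

theorem sum_range_quarter_mul_geometric (ε : ℝ) (K : ℕ) :
    ∑ l ∈ Finset.range K, ε / 4 * (3 / 4) ^ l = ε * (1 - (3 / 4) ^ K) := by
  induction K with
  | zero => simp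
  | succ K ih => rw [Finset.sum_range_succ, ih, pow_succ]; ring

theorem sum_range_div_two_pow_succ_le {d : ℝ} (hd : 0 ≤ d) (K : ℕ) :
    ∑ l ∈ Finset.range K, d / 2 ^ (l + 1) ≤ d := by
  have : ∑ l ∈ Finset.range K, d / 2 ^ (l + 1) = d * (1 - (1 / 2) ^ K) := by
    induction K with
    | zero => simp
    | succ K ih =>
      rw [Finset.sum_range_succ, ih, pow_succ, pow_succ, one_div, inv_pow]
      field_simp
      ring
  rw [this]
  have h2 : (0 : ℝ) ≤ (1 / 2) ^ K := by positivity
  nlinarith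

/-- The number of pulls of each arm in a duel at height `l`: the tolerance is
`ε / 4 * (3 / 4) ^ l`, the probability of failure is at most `d / 2 ^ (l + 1)`. -/
noncomputable def duelLength (ε d : ℝ) (l : ℕ) : ℕ :=
  ⌈128 / ε ^ 2 * (16 / 9) ^ l * ((l + 1) * Real.log 2 + Real.log (1 / d))⌉₊

theorem exp_duelLength_le {ε d : ℝ} (hε : 0 < ε) (hd : 0 < d) (l : ℕ) :
    Real.exp (-((ε / 4 * (3 / 4) ^ l) ^ 2 / 8 * duelLength ε d l)) ≤ d / 2 ^ (l + 1) := by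
  have h : 128 / ε ^ 2 * (16 / 9) ^ l * ((l + 1) * Real.log 2 + Real.log (1 / d))
      ≤ duelLength ε d l := Nat.le_ceil _
  have hp : (3 / 4 : ℝ) ^ l * (3 / 4) ^ l * (16 / 9) ^ l = 1 := by
    rw [← mul_pow, ← mul_pow]; norm_num
  have h2 := mul_le_mul_of_nonneg_left h
    (by positivity : (0 : ℝ) ≤ (ε / 4 * (3 / 4) ^ l) ^ 2 / 8)
  have e : (ε / 4 * (3 / 4) ^ l) ^ 2 / 8 *
      (128 / ε ^ 2 * (16 / 9) ^ l * ((l + 1) * Real.log 2 + Real.log (1 / d)))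
      = (l + 1) * Real.log 2 + Real.log (1 / d) := by
    calc _ = ((3 / 4 : ℝ) ^ l * (3 / 4) ^ l * (16 / 9) ^ l) *
          ((l + 1) * Real.log 2 + Real.log (1 / d)) := by field_simp; ring
      _ = _ := by rw [hp, one_mul]
  rw [e] at h2
  have hpos : 0 < d / 2 ^ (l + 1) := by positivity
  rw [← Real.le_log_iff_exp_le hpos, Real.log_div hd.ne' (by positivity), Real.log_pow]
  rw [one_div, Real.log_inv] at h2
  push_cast
  linarith

theorem duelLength_le {ε d : ℝ} (hε : 0 < ε) (hε1 : ε ≤ 1 / 8) (hd : 0 < d) (hd1 : d ≤ 1) (l : ℕ) :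
    (duelLength ε d l : ℝ)
      ≤ (16 / 9) ^ l * (l + 1) * (129 / ε ^ 2 * (1 + Real.log (1 / d))) := by
  have hL : 0 ≤ Real.log (1 / d) := Real.log_nonneg ((one_le_div hd).2 hd1)
  have hlog2 : 0 ≤ Real.log 2 := Real.log_nonneg (by norm_num)
  have hlog2' : Real.log 2 ≤ 1 := by linarith [Real.log_two_lt_d9]
  set L := Real.log (1 / d)
  have hceil := (Nat.ceil_lt_add_one (show 0 ≤ 128 / ε ^ 2 * (16 / 9) ^ l *
    (((l : ℝ) + 1) * Real.log 2 + L) by positivity)).le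
  refine hceil.trans ?_
  have hl : (0 : ℝ) ≤ l := Nat.cast_nonneg l
  have h1 : ((l : ℝ) + 1) * Real.log 2 + L ≤ (l + 1) * (1 + L) := by nlinarith
  have hpow : (1 : ℝ) ≤ (16 / 9) ^ l := one_le_pow₀ (by norm_num)
  have hone : 1 ≤ 1 / ε ^ 2 * ((16 / 9) ^ l * ((l + 1) * (1 + L))) := by
    have a1 : 1 ≤ 1 / ε ^ 2 := by rw [one_le_div (by positivity)]; nlinarith
    have a2 : 1 ≤ ((l : ℝ) + 1) * (1 + L) := by nlinarith
    exact one_le_mul_of_one_le_of_one_le a1 (one_le_mul_of_one_le_of_one_le hpow a2)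
  calc _ ≤ 128 / ε ^ 2 * (16 / 9) ^ l * ((l + 1) * (1 + L))
        + 1 / ε ^ 2 * ((16 / 9) ^ l * ((l + 1) * (1 + L))) := by gcongr
    _ = _ := by ring

/-- The algorithm that achieves the rate. -/
theorem exists_isPAC_samples_eq {β ε δ : ℝ} (hβ0 : 0 < β) (hβ1 : β < 1) (h0 : 1 ≤ m) (h : m < n)
    (hε : 0 < ε) (hε1 : ε ≤ 1 / 8) (hδ0 : 0 < δ) (hδ : δ ≤ ((n : ℝ) - m) / n * (1 - β)) :
    ∃ A : Algorithm n m, A.IsPAC ε δ ∧ ∃ N : ℕ,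
      (N : ℝ) ≤ 20898 * (1 + 2 / (-Real.log (1 - β))) * rate n m ε δ ∧ ∀ ω, A.samples ω = N := by
  set k := n - m with hk
  have hkR : (n : ℝ) - m = k := by rw [hk, Nat.cast_sub h.le]
  have hk1 : (1 : ℝ) ≤ k := by exact_mod_cast (show 1 ≤ k by omega)
  have hn : (0 : ℝ) < n := by exact_mod_cast (Nat.zero_le m).trans_lt h
  have hβ : 0 < 1 - β := by linarith
  set K := Nat.log 2 k + 1 with hKdef
  have hK : k < 2 ^ K := Nat.lt_pow_succ_log_self (by norm_num) k
  have hK2 : (2 : ℝ) ^ K ≤ 2 * k := by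
    have := Nat.pow_log_le_self 2 (show k ≠ 0 by omega)
    rw [hKdef, pow_succ]
    have h' : (2 : ℝ) ^ Nat.log 2 k ≤ k := by exact_mod_cast this
    linarith
  -- The best arm takes part in the tournament with probability `(k + 1) / n`.
  set d := n * δ / (k + 1) with hd
  have hd0 : 0 < d := by positivity
  have hnδ : n * δ ≤ k * (1 - β) := by
    rw [hkR] at hδ
    calc (n : ℝ) * δ ≤ n * (k / n * (1 - β)) := by gcongr
      _ = _ := by field_simp
  have hd1 : d ≤ 1 := by
    rw [hd, div_le_one (by positivity)]
    nlinarith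
  have hη0 : ∀ l : ℕ, 0 ≤ ε / 4 * (3 / 4) ^ l := fun l => by positivity
  have hη1 : ∀ l : ℕ, ε / 4 * (3 / 4) ^ l ≤ 1 := fun l => by
    have : (3 / 4 : ℝ) ^ l ≤ 1 := pow_le_one₀ (by norm_num) (by norm_num)
    nlinarith [show (0 : ℝ) ≤ (3 / 4) ^ l by positivity]
  have hηε : ∑ l ∈ Finset.range K, ε / 4 * (3 / 4 : ℝ) ^ l < ε := by
    rw [sum_range_quarter_mul_geometric]
    nlinarith [show (0 : ℝ) < (3 / 4) ^ K by positivity]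
  have hfail : ((n - m : ℕ) + 1) * ∑ l ∈ Finset.range K,
      Real.exp (-((ε / 4 * (3 / 4) ^ l) ^ 2 / 8 * duelLength ε d l)) ≤ n * δ := by
    have h1 : ∑ l ∈ Finset.range K,
        Real.exp (-((ε / 4 * (3 / 4) ^ l) ^ 2 / 8 * duelLength ε d l)) ≤ d :=
      (Finset.sum_le_sum fun l _ => exp_duelLength_le hε hd0 l).trans
        (sum_range_div_two_pow_succ_le hd0.le K)
    calc _ ≤ ((k : ℝ) + 1) * d := by gcongr
      _ = n * δ := by rw [hd]; field_simp
  refine ⟨_, isPAC_treeAlgorithm_retentionTree h0 h (duelLength ε d) K hK hη0 hη1 hηε hfail,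
    knockoutBudget (duelLength ε d) K, ?_, samples_treeAlgorithm _ _⟩
  set L := Real.log (1 / d) with hL
  have hL0 : 0 ≤ L := Real.log_nonneg ((one_le_div hd0).2 hd1)
  have hbudget := knockoutBudget_le (duelLength_le hε hε1 hd0 hd1) K
  set x := (k : ℝ) / (n * δ) with hx
  have hxpos : 0 < x := by positivity
  have hxβ : (1 - β)⁻¹ ≤ x := by
    have := inv_le_ratio hβ1 h hδ0 hδ
    rwa [hkR] at this
  have hy0 : 0 < -Real.log (1 - β) := neg_pos.2 (Real.log_neg hβ (by linarith))
  have hy : -Real.log (1 - β) ≤ Real.log x := by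
    rw [← Real.log_inv]; exact Real.log_le_log (by positivity) hxβ
  have hLx : 1 + L ≤ (1 + 2 / (-Real.log (1 - β))) * Real.log x := by
    have h1 : L ≤ Real.log 2 + Real.log x := by
      rw [← Real.log_mul two_ne_zero hxpos.ne', hL]
      refine Real.log_le_log (by positivity) ?_
      rw [hd, hx, one_div_div, ← mul_div_assoc]
      gcongr
      linarith
    have h2 : 1 ≤ Real.log x / (-Real.log (1 - β)) := (one_le_div hy0).2 hy
    have h3 : (1 + 2 / (-Real.log (1 - β))) * Real.log x
        = Real.log x + 2 * (Real.log x / (-Real.log (1 - β))) := by ring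
    rw [h3]
    linarith [Real.log_two_lt_d9]
  calc (knockoutBudget (duelLength ε d) K : ℝ)
      ≤ 2 ^ K * (129 / ε ^ 2 * (1 + L)) * (81 - (8 / 9) ^ K * (9 * K + 81)) := hbudget
    _ ≤ (2 * k) * (129 / ε ^ 2 * (1 + L)) * 81 := by
      refine mul_le_mul_of_nonneg (mul_le_mul_of_nonneg_right hK2 (by positivity)) ?_
        (by positivity) (by norm_num)
      have : (0 : ℝ) ≤ (8 / 9) ^ K * (9 * K + 81) := by positivity
      linarith
    _ = 20898 * (k / ε ^ 2) * (1 + L) := by ring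
    _ ≤ 20898 * (k / ε ^ 2) * ((1 + 2 / (-Real.log (1 - β))) * Real.log x) := by gcongr
    _ = _ := by rw [rate, hkR, ← hx]; ring

end UpperBound

end BestArmRetention

theorem theorem1 (β : ℝ) (hβ0 : 0 < β) (hβ1 : β < 1) :
    ∃ c C : ℝ, 0 < c ∧ 0 < C ∧
      ∀ (n m : ℕ) (ε δ : ℝ), 1 ≤ m → m < n → 0 < ε → ε ≤ 1 / 8 → 0 < δ →
        δ ≤ ((n : ℝ) - m) / n * (1 - β) →
        -- every PAC algorithm needs at least `c * rate` samples
        (∀ A : BestArmRetention.Algorithm n m, A.IsPAC ε δ →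
          ENNReal.ofReal (c * BestArmRetention.rate n m ε δ) ≤ A.sampleComplexity) ∧
        -- some PAC algorithm always draws the same number of samples, at most `C * rate`
        (∃ A : BestArmRetention.Algorithm n m, A.IsPAC ε δ ∧
          ∃ N : ℕ, (N : ℝ) ≤ C * BestArmRetention.rate n m ε δ ∧ ∀ ω, A.samples ω = N) ∧
        -- hence the sample complexity of the problem is of the order of `rate`
        ENNReal.ofReal (c * BestArmRetention.rate n m ε δ)
          ≤ BestArmRetention.sampleComplexity n m ε δ ∧
        BestArmRetention.sampleComplexity n m ε δ
          ≤ ENNReal.ofReal (C * BestArmRetention.rate n m ε δ) := by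
  have hy0 : 0 < -Real.log (1 - β) := neg_pos.2 (Real.log_neg (by linarith) (by linarith))
  refine ⟨(1 - (1 - Real.exp (-(-Real.log (1 - β)))) / (-Real.log (1 - β))) / 3,
    20898 * (1 + 2 / (-Real.log (1 - β))), ?_, by positivity, ?_⟩
  · have := BestArmRetention.one_sub_exp_neg_div_lt_one hy0
    linarith
  intro n m ε δ hm hmn hε hε1 hδ0 hδ
  have : NeZero n := ⟨by omega⟩
  have hlower := fun (A : BestArmRetention.Algorithm n m) (hA : A.IsPAC ε δ) =>
    hA.ofReal_rate_le hβ0 hβ1 hmn hε hε1 hδ0 hδ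
  obtain ⟨A, hA, N, hN, hsamples⟩ :=
    BestArmRetention.exists_isPAC_samples_eq hβ0 hβ1 hm hmn hε hε1 hδ0 hδ
  refine ⟨hlower, ⟨A, hA, N, hN, hsamples⟩, le_iInf₂ hlower, (iInf₂_le A hA).trans ?_⟩
  refine iSup_le fun ν => ?_
  simp only [hsamples, lintegral_const, measure_univ, mul_one]
  rw [ENat.toENNReal_coe, ← ENNReal.ofReal_natCast]
  exact ENNReal.ofReal_le_ofReal hN
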